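/- Let $M$ be a smooth manifold (Hausdorff, second countable) of dimension $4n$ with $n\ge 2$, and let $\mathcal Q\subset \mathrm{End}(TM)$ be an almost quaternionic structure, i.e. a subbundle that is locally spanned by smooth sections $J_1,J_2,J_3$ with $J_1^2=J_2^2=J_3^2=-1$ and $J_1J_2=-J_2J_1=J_3$. Let $\nabla$ be a quaternionic connection, i.e. a smooth linear connection on $TM$ such that $\nabla_X\sigma$ is a section of $\mathcal Q$ for every vector field $X$ and every smooth section $\sigma$ of $\mathcal Q$, and let $T^\nabla$ be its torsion tensor. Let $\pi:Z\to M$ be the twistor space, $$Z=\{J\in\mathcal Q_x : x\in M,\ J^2=-1\},$$ an embedded submanifold of the total space of $\mathrm{End}(TM)$ with fibre $S^2$. The connection $\nabla$ induces a splitting $T_JZ=H_J\oplus V_J$ into a horizontal space $H_J\cong T_{\pi(J)}M$ and the vertical space $V_J=\{B\in \mathcal Q_{\pi(J)} : BJ+JB=0\}$. Let $I_1^\nabla$ be the almost complex structure on $Z$ given by $$I_1^\nabla(X^h)=(JX)^h\quad (X\in T_{\pi(J)}M),\qquad I_1^\nabla(B)=JB\quad (B\in V_J),$$ where $X^h\in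 H_J$ is the horizontal lift of $X$. Then the following conditions are equivalent: (i) $I_1^\nabla$ is integrable, i.e. its Nijenhuis tensor $[I_1^\nabla U,I_1^\nabla W]-[U,W]-I_1^\nabla[I_1^\nabla U,W]-I_1^\nabla[U,I_1^\nabla W]$ vanishes for all local vector fields $U,W$ on $Z$; (ii) the $(0,2)_J$-part of the torsion vanishes for every $J\in Z$, i.e. for all $x\in M$, all $J\in\mathcal Q_x$ with $J^2=-1$ and all $X,Y\in T_xM$, $$(T^\nabla)^{0,2}_J(X,Y)=\tfrac14\bigl(T^\nabla(JX,JY)-T^\nabla(X,Y)-J\,T^\nabla(JX,Y)-J\,T^\nabla(X,JY)\bigr)=0 .$$ -/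

import Mathlib

open Bundle Topology
open scoped Manifold ContDiff

section Bundles

variable (E : Type*) [NormedAddCommGroup E] [NormedSpace ℝ E]
  (M : Type*) [TopologicalSpace M] [ChartedSpace E M]

/-- The fibre `End(T_x M)` of the endomorphism bundle. -/
abbrev EndFiber (x : M) : Type _ := TangentSpace 𝓘(ℝ, E) x →L[ℝ] TangentSpace 𝓘(ℝ, E) x

variable [IsManifold 𝓘(ℝ, E) ∞ M]

/-- The total space of the bundle `End(TM)`, a smooth manifold. -/
abbrev EndTotal : Type _ := TotalSpace (E →L[ℝ] E) (EndFiber E M)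

/-- The model of the manifold `End(TM)`. -/
noncomputable abbrev endModel : ModelWithCorners ℝ (E × (E →L[ℝ] E)) (ModelProd E (E →L[ℝ] E)) :=
  𝓘(ℝ, E).prod 𝓘(ℝ, E →L[ℝ] E)

/-- The tangent space of the manifold `End(TM)` at `A`. -/
abbrev EndTangent (A : EndTotal E M) : Type _ := TangentSpace (endModel E) A

end Bundles

section Definitions

variable {E : Type*} [NormedAddCommGroup E] [NormedSpace ℝ E]
  {M : Type*} [TopologicalSpace M] [ChartedSpace E M] [IsManifold 𝓘(ℝ, E) ∞ M]

/-! ### Almost quaternionic structures -/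

/-- `J₁, J₂, J₃` is an almost hypercomplex structure on the set `U`: it consists of smooth sections
of `End(TM)` over `U` that satisfy the quaternionic identities. -/
structure IsAlmostHypercomplexOn (J₁ J₂ J₃ : ∀ x : M, EndFiber E M x) (U : Set M) : Prop where
  smooth₁ : ContMDiffOn 𝓘(ℝ, E) (endModel E) ∞ (fun x ↦ (⟨x, J₁ x⟩ : EndTotal E M)) U
  smooth₂ : ContMDiffOn 𝓘(ℝ, E) (endModel E) ∞ (fun x ↦ (⟨x, J₂ x⟩ : EndTotal E M)) U
  smooth₃ : ContMDiffOn 𝓘(ℝ, E) (endModel E) ∞ (fun x ↦ (⟨x, J₃ x⟩ : EndTotal E M)) U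
  sq₁ : ∀ x ∈ U, J₁ x ∘L J₁ x = -ContinuousLinearMap.id ℝ _
  sq₂ : ∀ x ∈ U, J₂ x ∘L J₂ x = -ContinuousLinearMap.id ℝ _
  sq₃ : ∀ x ∈ U, J₃ x ∘L J₃ x = -ContinuousLinearMap.id ℝ _
  mul₁₂ : ∀ x ∈ U, J₁ x ∘L J₂ x = J₃ x
  mul₂₁ : ∀ x ∈ U, J₂ x ∘L J₁ x = -J₃ x

variable (E M) in
/-- An almost quaternionic structure on `M`: a family of subspaces `Q_x ⊆ End(T_x M)` which near
every point is spanned by an almost hypercomplex structure (an admissible basis). -/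
structure AlmostQuaternionicStructure where
  fiber : ∀ x : M, Submodule ℝ (EndFiber E M x)
  exists_admissible : ∀ x₀ : M, ∃ U : Set M, IsOpen U ∧ x₀ ∈ U ∧
    ∃ J₁ J₂ J₃ : ∀ x : M, EndFiber E M x, IsAlmostHypercomplexOn J₁ J₂ J₃ U ∧
      ∀ x ∈ U, fiber x = Submodule.span ℝ {J₁ x, J₂ x, J₃ x}

/-- The twistor space `Z`, as a subset of the manifold `End(TM)`: all `J ∈ Q_x`, `x ∈ M`, with
`J² = -1`. -/
def AlmostQuaternionicStructure.twistorSpace (Q : AlmostQuaternionicStructure E M) :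
    Set (EndTotal E M) :=
  {A | A.2 ∈ Q.fiber A.1 ∧ A.2 ∘L A.2 = -ContinuousLinearMap.id ℝ _}

/-! ### The connection induced on `End(TM)` -/

theorem tensorialAt_endCov (cov : CovariantDerivative 𝓘(ℝ, E) E (TangentSpace 𝓘(ℝ, E) : M → Type _))
    (σ : ∀ x : M, EndFiber E M x) (x : M) (X : TangentSpace 𝓘(ℝ, E) x)
    (hσ : MDifferentiableAt 𝓘(ℝ, E) (endModel E) (fun y ↦ (⟨y, σ y⟩ : EndTotal E M)) x) :
    TensorialAt 𝓘(ℝ, E) E (fun Y : ∀ y : M, TangentSpace 𝓘(ℝ, E) y ↦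
      cov (fun y ↦ σ y (Y y)) x X - σ x (cov Y x X)) x where
  smul {f Y} hf hY := by
    have h1 : (fun y ↦ σ y ((f • Y) y)) = f • (fun y ↦ σ y (Y y)) := by
      ext1 y; simp
    have h2 := hσ.clm_bundle_apply hY
    rw [h1, cov.isCovariantDerivativeOnUniv.leibniz h2 hf,
      cov.isCovariantDerivativeOnUniv.leibniz hY hf]
    simp [smul_sub]
  add {Y Y'} hY hY' := by
    have h1 : (fun y ↦ σ y ((Y + Y') y)) = (fun y ↦ σ y (Y y)) + (fun y ↦ σ y (Y' y)) := by
      ext1 y; simp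
    rw [h1, cov.isCovariantDerivativeOnUniv.add (hσ.clm_bundle_apply hY) (hσ.clm_bundle_apply hY'),
      cov.isCovariantDerivativeOnUniv.add hY hY']
    simp only [add_apply, map_add]
    abel

variable [FiniteDimensional ℝ E]

open Classical in
/-- The covariant derivative `∇_X σ ∈ End(T_x M)` of a section `σ` of `End(TM)` that is
differentiable at `x`: `(∇_X σ) Y = ∇_X (σ Y) - σ (∇_X Y)` for all vector fields `Y`. -/
noncomputable def endCov
    (cov : CovariantDerivative 𝓘(ℝ, E) E (TangentSpace 𝓘(ℝ, E) : M → Type _))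
    (σ : ∀ x : M, EndFiber E M x) (x : M) (X : TangentSpace 𝓘(ℝ, E) x) : EndFiber E M x :=
  if hσ : MDifferentiableAt 𝓘(ℝ, E) (endModel E) (fun y ↦ (⟨y, σ y⟩ : EndTotal E M)) x then
    TensorialAt.mkHom (fun Y : ∀ y : M, TangentSpace 𝓘(ℝ, E) y ↦
      cov (fun y ↦ σ y (Y y)) x X - σ x (cov Y x X)) x (tensorialAt_endCov cov σ x X hσ)
  else 0

/-- A quaternionic connection: a smooth linear connection on `TM` such that `∇_X σ` is a section of
`Q` for every smooth section `σ` of `Q`. -/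
structure IsQuaternionicConnection (Q : AlmostQuaternionicStructure E M)
    (cov : CovariantDerivative 𝓘(ℝ, E) E (TangentSpace 𝓘(ℝ, E) : M → Type _)) : Prop where
  smooth : cov.ContMDiffCovariantDerivative ∞
  preserves : ∀ σ : ∀ x : M, EndFiber E M x,
    ContMDiff 𝓘(ℝ, E) (endModel E) ∞ (fun x ↦ (⟨x, σ x⟩ : EndTotal E M)) →
    (∀ x, σ x ∈ Q.fiber x) → ∀ (x : M) (X : TangentSpace 𝓘(ℝ, E) x), endCov cov σ x X ∈ Q.fiber x

/-! ### Horizontal and vertical vectors on `End(TM)` -/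

/-- The vertical vector at `A` given by `B ∈ End(T_x M)`: the velocity at `t = 0` of `A + t B`. -/
noncomputable def verticalLift (A : EndTotal E M) (B : EndFiber E M A.1) : EndTangent E M A :=
  mfderiv 𝓘(ℝ, ℝ) (endModel E) (fun t : ℝ ↦ (⟨A.1, A.2 + t • B⟩ : EndTotal E M)) 0 (1 : ℝ)

/-- The differential at `A` of the projection `End(TM) → M`. -/
noncomputable def projDeriv (A : EndTotal E M) :
    EndTangent E M A →L[ℝ] TangentSpace 𝓘(ℝ, E) A.1 :=
  mfderiv (endModel E) 𝓘(ℝ, E) (fun p : EndTotal E M ↦ p.1) A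

/-- The horizontal lift of `X ∈ T_x M` to `A ∈ End(T_x M)`: it is `dσ(X) - (∇_X σ)ᵛ` for a local
section `σ` of `End(TM)` with `σ(x) = A`, and does not depend on the choice of `σ`. -/
noncomputable def horizontalLift
    (cov : CovariantDerivative 𝓘(ℝ, E) E (TangentSpace 𝓘(ℝ, E) : M → Type _))
    (A : EndTotal E M) (X : TangentSpace 𝓘(ℝ, E) A.1) : EndTangent E M A :=
  letI σ : ∀ y : M, EndFiber E M y := FiberBundle.extend (E →L[ℝ] E) A.2
  letI dσX : EndTangent E M A :=
    mfderiv 𝓘(ℝ, E) (endModel E) (fun y ↦ (⟨y, σ y⟩ : EndTotal E M)) A.1 X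
  dσX - verticalLift A (endCov cov σ A.1 X)

end Definitions

section VerticalPart

variable {E : Type*} [NormedAddCommGroup E] [NormedSpace ℝ E]
  {M : Type*} [TopologicalSpace M] [ChartedSpace E M] [IsManifold 𝓘(ℝ, E) ∞ M]

theorem projDeriv_trivialization (A : EndTotal E M) (W : EndTangent E M A)
    (h1 : projDeriv A W = 0)
    (h2 : mfderiv (endModel E) 𝓘(ℝ, E →L[ℝ] E)
      (fun p : EndTotal E M ↦ (trivializationAt (E →L[ℝ] E) (EndFiber E M) A.1 p).2) A W = 0) :
    W = 0 := by
  set e := trivializationAt (E →L[ℝ] E) (EndFiber E M) A.1 with he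
  have hA : A ∈ e.source := FiberBundle.mem_trivializationAt_proj_source
  have hd := e.mdifferentiable (I := 𝓘(ℝ, E))
  have hinj := hd.mfderiv_injective hA
  have hdA : MDifferentiableAt (endModel E) (endModel E) e A := hd.mdifferentiableAt hA
  have hfst : MDifferentiableAt (endModel E) 𝓘(ℝ, E) (fun p ↦ (e p).1) A := hdA.fst
  have hsnd : MDifferentiableAt (endModel E) 𝓘(ℝ, E →L[ℝ] E) (fun p ↦ (e p).2) A := hdA.snd
  apply hinj
  refine Eq.trans ?_ (ContinuousLinearMap.map_zero _).symm
  have h3 : mfderiv (endModel E) (endModel E) (fun p ↦ ((e p).1, (e p).2)) A W =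
    (mfderiv (endModel E) 𝓘(ℝ, E) (fun p ↦ (e p).1) A W,
      mfderiv (endModel E) 𝓘(ℝ, E →L[ℝ] E) (fun p ↦ (e p).2) A W) := by
    rw [mfderiv_prodMk hfst hsnd]; rfl
  have h4 : mfderiv (endModel E) 𝓘(ℝ, E) (fun p ↦ (e p).1) A W = 0 := by
    have : (fun p ↦ (e p).1) =ᶠ[𝓝 A] (fun p : EndTotal E M ↦ p.1) := by
      filter_upwards [e.open_source.mem_nhds hA] with p hp
      exact e.coe_fst hp
    rw [this.mfderiv_eq]
    exact h1
  refine h3.trans ?_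
  rw [h4, h2]
  rfl

theorem mdifferentiableAt_add_smul (A : EndTotal E M) (B : EndFiber E M A.1) :
    MDifferentiableAt 𝓘(ℝ, ℝ) (endModel E)
      (fun t : ℝ ↦ (⟨A.1, A.2 + t • B⟩ : EndTotal E M)) 0 := by
  set e := trivializationAt (E →L[ℝ] E) (EndFiber E M) A.1 with he
  have hx : A.1 ∈ e.baseSet := FiberBundle.mem_baseSet_trivializationAt' A.1
  rw [mdifferentiableAt_totalSpace]
  refine ⟨mdifferentiableAt_const, ?_⟩
  have : (fun t : ℝ ↦ (e ⟨A.1, A.2 + t • B⟩).2) =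
      fun t : ℝ ↦ e.continuousLinearMapAt ℝ A.1 A.2 + t • e.continuousLinearMapAt ℝ A.1 B := by
    ext1 t
    rw [← map_smul, ← map_add, e.continuousLinearMapAt_apply_of_mem ℝ hx]
  change MDifferentiableAt 𝓘(ℝ, ℝ) 𝓘(ℝ, E →L[ℝ] E) (fun t : ℝ ↦ (e ⟨A.1, A.2 + t • B⟩).2) 0
  rw [this]
  apply DifferentiableAt.mdifferentiableAt
  fun_prop

theorem mfderiv_verticalLift {F : Type*} [NormedAddCommGroup F] [NormedSpace ℝ F] {H N : Type*}
    [TopologicalSpace H] {J : ModelWithCorners ℝ F H} [TopologicalSpace N] [ChartedSpace H N]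
    (g : EndTotal E M → N)
    (A : EndTotal E M) (hg : MDifferentiableAt (endModel E) J g A) (B : EndFiber E M A.1) :
    (mfderiv (endModel E) J g A (verticalLift A B) : F) =
      mfderiv 𝓘(ℝ, ℝ) J (fun t : ℝ ↦ g ⟨A.1, A.2 + t • B⟩) 0 (1 : ℝ) := by
  have c0 : (⟨A.1, A.2 + (0 : ℝ) • B⟩ : EndTotal E M) = A := by simp
  have h1 : mfderiv 𝓘(ℝ, ℝ) J (fun t : ℝ ↦ g ⟨A.1, A.2 + t • B⟩) 0 = _ :=
    mfderiv_comp (0 : ℝ) (g := g) (by rw [c0]; exact hg) (mdifferentiableAt_add_smul A B)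
  have h2 : ∀ p : EndTotal E M, p = A →
      (mfderiv (endModel E) J g p : (E × (E →L[ℝ] E)) →L[ℝ] F) = mfderiv (endModel E) J g A := by
    rintro _ rfl; rfl
  rw [h1]
  have h3 := h2 _ c0
  exact (DFunLike.congr_fun h3 (verticalLift A B)).symm

theorem projDeriv_verticalLift (A : EndTotal E M) (B : EndFiber E M A.1) :
    projDeriv A (verticalLift A B) = 0 := by
  refine (mfderiv_verticalLift (J := 𝓘(ℝ, E)) (fun p : EndTotal E M ↦ p.1) A
    (mdifferentiableAt_proj _) B).trans ?_
  simp only [mfderiv_const]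
  rfl

theorem mfderiv_trivialization_verticalLift (A : EndTotal E M) (B : EndFiber E M A.1) :
    mfderiv (endModel E) 𝓘(ℝ, E →L[ℝ] E)
      (fun p : EndTotal E M ↦ (trivializationAt (E →L[ℝ] E) (EndFiber E M) A.1 p).2) A
        (verticalLift A B) =
      (trivializationAt (E →L[ℝ] E) (EndFiber E M) A.1).continuousLinearMapAt ℝ A.1 B := by
  set e := trivializationAt (E →L[ℝ] E) (EndFiber E M) A.1 with he
  have hx : A.1 ∈ e.baseSet := FiberBundle.mem_baseSet_trivializationAt' A.1
  have hA : A ∈ e.source := FiberBundle.mem_trivializationAt_proj_source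
  have hdA : MDifferentiableAt (endModel E) (endModel E) e A :=
    (e.mdifferentiable (I := 𝓘(ℝ, E))).mdifferentiableAt hA
  refine (mfderiv_verticalLift (J := 𝓘(ℝ, E →L[ℝ] E)) (fun p : EndTotal E M ↦ (e p).2) A
    hdA.snd B).trans ?_
  have : (fun t : ℝ ↦ (e ⟨A.1, A.2 + t • B⟩).2) =
      fun t : ℝ ↦ e.continuousLinearMapAt ℝ A.1 A.2 + t • e.continuousLinearMapAt ℝ A.1 B := by
    ext1 t
    rw [← map_smul, ← map_add, e.continuousLinearMapAt_apply_of_mem ℝ hx]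
  rw [this, mfderiv_eq_fderiv]
  have hd : HasDerivAt (fun t : ℝ ↦
      e.continuousLinearMapAt ℝ A.1 A.2 + t • e.continuousLinearMapAt ℝ A.1 B)
      ((1 : ℝ) • e.continuousLinearMapAt ℝ A.1 B) 0 :=
    ((hasDerivAt_id (0 : ℝ)).smul_const _).const_add _
  rw [one_smul] at hd
  exact hd.deriv

theorem existsUnique_verticalLift (A : EndTotal E M) (W : EndTangent E M A)
    (h : projDeriv A W = 0) : ∃! B : EndFiber E M A.1, verticalLift A B = W := by
  set e := trivializationAt (E →L[ℝ] E) (EndFiber E M) A.1 with he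
  have hx : A.1 ∈ e.baseSet := FiberBundle.mem_baseSet_trivializationAt' A.1
  refine ⟨e.symmL ℝ A.1 (mfderiv (endModel E) 𝓘(ℝ, E →L[ℝ] E)
      (fun p : EndTotal E M ↦ (e p).2) A W), ?_, ?_⟩
  · refine sub_eq_zero.mp (projDeriv_trivialization A _ ?_ ?_)
    · refine (ContinuousLinearMap.map_sub _ _ _).trans (sub_eq_zero.mpr ?_)
      rw [projDeriv_verticalLift, h]
    · refine (ContinuousLinearMap.map_sub _ _ _).trans (sub_eq_zero.mpr ?_)
      refine (mfderiv_trivialization_verticalLift A _).trans ?_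
      exact e.continuousLinearMapAt_symmL hx _
  · rintro B rfl
    refine Eq.trans (e.symmL_continuousLinearMapAt (R := ℝ) hx B).symm ?_
    exact congrArg (e.symmL ℝ A.1) (mfderiv_trivialization_verticalLift A B).symm


theorem projDeriv_horizontalLift [FiniteDimensional ℝ E]
    (cov : CovariantDerivative 𝓘(ℝ, E) E (TangentSpace 𝓘(ℝ, E) : M → Type _))
    (A : EndTotal E M) (X : TangentSpace 𝓘(ℝ, E) A.1) :
    projDeriv A (horizontalLift cov A X) = X := by
  refine (ContinuousLinearMap.map_sub _ _ _).trans ?_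
  rw [projDeriv_verticalLift, sub_zero]
  set σ : ∀ y : M, EndFiber E M y := FiberBundle.extend (E →L[ℝ] E) A.2 with hσ
  have hd : MDifferentiableAt 𝓘(ℝ, E) (endModel E) (fun y ↦ (⟨y, σ y⟩ : EndTotal E M)) A.1 :=
    FiberBundle.mdifferentiableAt_extend 𝓘(ℝ, E) (E →L[ℝ] E) A.2
  have c0 : (⟨A.1, σ A.1⟩ : EndTotal E M) = A := by simp [hσ]
  have h1 : mfderiv 𝓘(ℝ, E) 𝓘(ℝ, E) (fun y : M ↦ y) A.1 = _ :=
    mfderiv_comp A.1 (I' := endModel E) (g := fun p : EndTotal E M ↦ p.1)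
      (mdifferentiableAt_proj _) hd
  have h2 : ∀ p : EndTotal E M, p = A →
      (mfderiv (endModel E) 𝓘(ℝ, E) (fun q : EndTotal E M ↦ q.1) p : (E × (E →L[ℝ] E)) →L[ℝ] E) =
        mfderiv (endModel E) 𝓘(ℝ, E) (fun q : EndTotal E M ↦ q.1) A := by
    rintro _ rfl; rfl
  have h4 := h2 _ c0
  have h3 := DFunLike.congr_fun h4
    (mfderiv 𝓘(ℝ, E) (endModel E) (fun y ↦ (⟨y, σ y⟩ : EndTotal E M)) A.1 X)
  refine h3.symm.trans ?_
  refine (DFunLike.congr_fun h1 X).symm.trans ?_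
  exact DFunLike.congr_fun (mfderiv_id (I := 𝓘(ℝ, E)) (x := A.1)) X


variable [FiniteDimensional ℝ E]

/-- The vertical part of `W ∈ T_A End(TM)` in the splitting into horizontal and vertical vectors,
as an element of `End(T_x M)`: the unique `B` with `Bᵛ = W - (π_* W)ʰ`. -/
noncomputable def verticalPart
    (cov : CovariantDerivative 𝓘(ℝ, E) E (TangentSpace 𝓘(ℝ, E) : M → Type _))
    (A : EndTotal E M) (W : EndTangent E M A) : EndFiber E M A.1 :=
  (existsUnique_verticalLift A (W - horizontalLift cov A (projDeriv A W)) (by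
    refine (ContinuousLinearMap.map_sub _ _ _).trans ?_
    rw [projDeriv_horizontalLift, sub_self])).choose

end VerticalPart

section Twistor

variable {E : Type*} [NormedAddCommGroup E] [NormedSpace ℝ E] [FiniteDimensional ℝ E]
  {M : Type*} [TopologicalSpace M] [ChartedSpace E M] [IsManifold 𝓘(ℝ, E) ∞ M]

/-! ### The almost complex structure on the twistor space -/

/-- The map `W ↦ (J π_* W)ʰ + (J ∘ v W)ᵛ` on the tangent space of `End(TM)` at `J`, where `v` is the
vertical part. For `J` in the twistor space `Z`, the tangent space `T_J Z` is the sum of the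
horizontal space and of the vertical vectors `Bᵛ` with `B ∈ Q_x`, `B J = -J B`, and the restriction
of the map to `T_J Z` is the almost complex structure `I₁^∇`. -/
noncomputable def twistorI
    (cov : CovariantDerivative 𝓘(ℝ, E) E (TangentSpace 𝓘(ℝ, E) : M → Type _))
    (J : EndTotal E M) (W : EndTangent E M J) : EndTangent E M J :=
  horizontalLift cov J (J.2 (projDeriv J W)) + verticalLift J (J.2 ∘L verticalPart cov J W)

/-- `W` is tangent at `A` to the subset `S` of `End(TM)`: it is the velocity of a smooth curve
in `S` through `A`. -/
def IsTangentTo (S : Set (EndTotal E M)) (A : EndTotal E M) (W : EndTangent E M A) : Prop :=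
  ∃ γ : ℝ → EndTotal E M, γ 0 = A ∧ (∀ᶠ t in 𝓝 0, γ t ∈ S) ∧
    ContMDiffAt 𝓘(ℝ, ℝ) (endModel E) ∞ γ 0 ∧ W = mfderiv 𝓘(ℝ, ℝ) (endModel E) γ 0 (1 : ℝ)

/-- `U` is a smooth vector field on the open subset `O` of `End(TM)` that is tangent to `S` along
`S ∩ O`. If `S` is an embedded submanifold, then `U` restricts to a vector field on `S ∩ O`, every
vector field on `S` is locally of this form, and Lie brackets on `S` are the restrictions of the
Lie brackets on `End(TM)`. -/
structure IsVectorFieldAlong (S O : Set (EndTotal E M)) (U : ∀ A : EndTotal E M, EndTangent E M A) :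
    Prop where
  smooth : ContMDiffOn (endModel E) (endModel E).tangent ∞
    (fun A ↦ (⟨A, U A⟩ : TangentBundle (endModel E) (EndTotal E M))) O
  tangent : ∀ A ∈ S ∩ O, IsTangentTo S A (U A)

/-- The almost complex structure `I = I₁^∇` on the twistor space `Z` is integrable: its Nijenhuis
tensor `[IU, IW] - [U, W] - I[IU, W] - I[U, IW]` vanishes for all locally defined vector fields
`U`, `W` on `Z`. The vector fields `U`, `W` and `U' = IU`, `W' = IW` on `Z` are represented by vector
fields on open sets of `End(TM)`. -/
def TwistorIntegrable (Q : AlmostQuaternionicStructure E M)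
    (cov : CovariantDerivative 𝓘(ℝ, E) E (TangentSpace 𝓘(ℝ, E) : M → Type _)) : Prop :=
  ∀ (O : Set (EndTotal E M)) (U W U' W' : ∀ A : EndTotal E M, EndTangent E M A), IsOpen O →
    IsVectorFieldAlong Q.twistorSpace O U → IsVectorFieldAlong Q.twistorSpace O W →
    IsVectorFieldAlong Q.twistorSpace O U' → IsVectorFieldAlong Q.twistorSpace O W' →
    (∀ A ∈ Q.twistorSpace ∩ O, U' A = twistorI cov A (U A) ∧ W' A = twistorI cov A (W A)) →
    ∀ A ∈ Q.twistorSpace ∩ O,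
      VectorField.mlieBracket (endModel E) U' W' A - VectorField.mlieBracket (endModel E) U W A
        - twistorI cov A (VectorField.mlieBracket (endModel E) U' W A)
        - twistorI cov A (VectorField.mlieBracket (endModel E) U W' A) = 0

/-- The `(0,2)_J`-part of a vector-valued bilinear form `B`. -/
noncomputable def part02 {V : Type*} [AddCommGroup V] [Module ℝ V] (B : V → V → V) (J : V → V)
    (X Y : V) : V :=
  (1 / 4 : ℝ) • (B (J X) (J Y) - B X Y - J (B (J X) Y) - J (B X (J Y)))

end Twistor

/-!
Everything is computed in the charts of `M` and of `End(TM)`. In a chart the connection is `d + Γ`,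
a point of `End(TM)` is a pair `(x, a)`, its horizontal vectors are `(ξ, -[Γ ξ, a])`, and
`I = I₁^∇` becomes the explicit map `localTwistorI`. Vector fields tangent to the twistor space `Z`
may be differentiated along curves in `Z`, where the relation `U' = I U` holds. This gives, for
tangent fields `U`, `W` over `X`, `Y` (`IsLocalQuaternionicConnection.nijenhuis_eq`):

* the horizontal part of the Nijenhuis tensor is the lift of `-4 T^{0,2}_J(X, Y)`;
* its vertical part is `-4 [R, J]^{0,2}_J(X, Y)`, where `R` is the curvature of `∇`.

Hence integrability implies `T^{0,2}_J = 0`: the horizontal lifts of the coordinate fields `ξ` and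
of `J ξ` are tangent to `Z` because `∇` preserves `Q`, and they exhibit every value of the torsion.

For the converse, `Ω = [R, J]^{0,2}_J` has to vanish as soon as all `T^{0,2}_J` do. Differentiating
`T^{0,2}_J = 0` along horizontal curves in `Z` gives `(∇_ξ T)^{0,2}_J = 0`. Inserting this into the
first Bianchi identity yields `Ω(X, Y) Z + Ω(Y, Z) X + Ω(Z, X) Y = 0`
(`cyclic_sum_antiPart_curvature`). Moreover `Ω(X, Y)` lies in `Q`, since curvature acts on `Q`
(`IsLocalQuaternionicConnection.curvature_mem`). If `Ω(X, Y) ≠ 0`, then `Ω(X, Y)` is an invertible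
quaternion, and the cyclic identity shows that its image, the whole tangent space, is contained in
`Q X + Q Y`, which has dimension at most `6`. This contradicts `4 n ≥ 8`
(`IsQuaternionicTriple.eq_zero_of_cyclic`). This is the only use of `n ≥ 2`.
-/

/-! ### Pointwise algebra of a connection in a chart -/

section LocalModel

variable {E : Type*} [NormedAddCommGroup E] [NormedSpace ℝ E]

/-- The torsion of the connection `d + Γ` on an open subset of `E`, where `G = Γ x`. -/
noncomputable def localTorsion (G : E →L[ℝ] E →L[ℝ] E) (X Y : E) : E := G X Y - G Y X

/-- The curvature of the connection `d + Γ` on an open subset of `E`, where `G = Γ x` and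
`D = dΓ x`. -/
noncomputable def localCurvature (G : E →L[ℝ] E →L[ℝ] E) (D : E →L[ℝ] E →L[ℝ] E →L[ℝ] E)
    (X Y : E) : E →L[ℝ] E :=
  D X Y - D Y X + (G X * G Y - G Y * G X)

/-- Four times the `(0,2)`-part of a vector-valued form `B`, where `j` and `k` are the complex
structures on the source and on the target. -/
def antiPart {V W : Type*} [AddCommGroup W] (B : V → V → W) (j : V → V) (k : W → W)
    (X Y : V) : W :=
  B (j X) (j Y) - B X Y - k (B (j X) Y) - k (B X (j Y))

/-- The coordinate expression at `(x, a)` of the map `twistorI`, where `G = Γ x`. -/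
noncomputable def localTwistorI (G : E →L[ℝ] E →L[ℝ] E) (a : E →L[ℝ] E)
    (v : E × (E →L[ℝ] E)) : E × (E →L[ℝ] E) :=
  (a v.1, a * (v.2 + (G v.1 * a - a * G v.1)) - (G (a v.1) * a - a * G (a v.1)))

/-- The derivative of `localTwistorI` when `(x, a)` has velocity `p'` and the vector `v` has
velocity `v'`, where `G = Γ x` and `D = dΓ x`. -/
noncomputable def localTwistorIDeriv (G : E →L[ℝ] E →L[ℝ] E) (D : E →L[ℝ] E →L[ℝ] E →L[ℝ] E)
    (a : E →L[ℝ] E) (v p' v' : E × (E →L[ℝ] E)) : E × (E →L[ℝ] E) :=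
  (p'.2 v.1 + a v'.1,
    p'.2 * (v.2 + (G v.1 * a - a * G v.1))
    + a * (v'.2 + ((D p'.1 v.1 + G v'.1) * a + G v.1 * p'.2
      - (p'.2 * G v.1 + a * (D p'.1 v.1 + G v'.1))))
    - ((D p'.1 (a v.1) + G (p'.2 v.1 + a v'.1)) * a + G (a v.1) * p'.2
      - (p'.2 * G (a v.1) + a * (D p'.1 (a v.1) + G (p'.2 v.1 + a v'.1)))))

set_option synthInstance.maxHeartbeats 200000 in
theorem HasDerivAt.localTwistorI {Γ : E → E →L[ℝ] E →L[ℝ] E} {p v : ℝ → E × (E →L[ℝ] E)}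
    {p' v' : E × (E →L[ℝ] E)} {t : ℝ} (hΓ : DifferentiableAt ℝ Γ (p t).1)
    (hp : HasDerivAt p p' t) (hv : HasDerivAt v v' t) :
    HasDerivAt (fun s ↦ localTwistorI (Γ (p s).1) (p s).2 (v s))
      (localTwistorIDeriv (Γ (p t).1) (fderiv ℝ Γ (p t).1) (p t).2 (v t) p' v') t := by
  have hx : HasDerivAt (fun s ↦ (p s).1) p'.1 t := hp.fst
  have ha : HasDerivAt (fun s ↦ (p s).2) p'.2 t := hp.snd
  have hX : HasDerivAt (fun s ↦ (v s).1) v'.1 t := hv.fst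
  have hB : HasDerivAt (fun s ↦ (v s).2) v'.2 t := hv.snd
  have hG : HasDerivAt (fun s ↦ Γ (p s).1) (fderiv ℝ Γ (p t).1 p'.1) t :=
    HasFDerivAt.comp_hasDerivAt (l := Γ) t hΓ.hasFDerivAt hx
  have haX := ha.clm_apply hX
  have hGX := hG.clm_apply hX
  have hGaX := hG.clm_apply haX
  exact haX.prodMk ((ha.mul (hB.add ((hGX.mul ha).sub (ha.mul hGX)))).sub
    ((hGaX.mul ha).sub (ha.mul hGaX)))

/-- The Nijenhuis tensor at a point, with the derivatives of the vector fields as free variables: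
`u`, `w` are the values of `U`, `W`, and `m₁ = dW(I U)`, `m₂ = dU(I W)`, `m₃ = dW(U)`,
`m₄ = dU(W)`. The derivatives of `I U` and `I W` are given by `localTwistorIDeriv`, so all `mᵢ`
cancel and only torsion and curvature remain. The hypotheses on `u` and `w` hold for vectors tangent
to `{a * a = -1}`. -/
theorem nijenhuis_algebra (G : E →L[ℝ] E →L[ℝ] E) (D : E →L[ℝ] E →L[ℝ] E →L[ℝ] E)
    (a : E →L[ℝ] E) (u w m₁ m₂ m₃ m₄ : E × (E →L[ℝ] E)) (ha : a * a = -1)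
    (hu : u.2 * a = -(a * u.2)) (hw : w.2 * a = -(a * w.2)) :
    letI Φ := localTwistorI G a
    letI dΦ := localTwistorIDeriv G D a
    letI N₁ := - antiPart (localTorsion G) a a u.1 w.1
    dΦ w (Φ u) m₁ - dΦ u (Φ w) m₂ - (m₃ - m₄)
      - Φ (m₁ - dΦ u w m₄) - Φ (dΦ w u m₃ - m₂) =
    (N₁, -(G N₁ * a - a * G N₁)
      - antiPart (fun X Y ↦ localCurvature G D X Y * a - a * localCurvature G D X Y)
        a (a * ·) u.1 w.1) := by
  obtain ⟨X, b⟩ := u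
  obtain ⟨Y, c⟩ := w
  simp only at hu hw
  have haa : ∀ v : E, a (a v) = -v := fun v ↦ by
    have := DFunLike.congr_fun ha v
    simpa using this
  have hpp : ∀ z : E →L[ℝ] E, a * (a * z) = -z := fun z ↦ by rw [← mul_assoc, ha]; simp
  have huu : ∀ z : E →L[ℝ] E, b * (a * z) = -(a * (b * z)) := fun z ↦ by
    rw [← mul_assoc, hu]; simp [mul_assoc]
  have hww : ∀ z : E →L[ℝ] E, c * (a * z) = -(a * (c * z)) := fun z ↦ by
    rw [← mul_assoc, hw]; simp [mul_assoc]
  refine Prod.ext ?_ ?_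
  · simp only [localTwistorI, localTwistorIDeriv, antiPart, localTorsion, Prod.fst_sub,
      Prod.snd_sub, map_add, map_sub, mul_apply_eq_comp, haa, add_apply, sub_apply]
    abel
  · simp only [localTwistorI, localTwistorIDeriv, antiPart, localTorsion, localCurvature,
      Prod.fst_sub, Prod.snd_sub, map_add, map_sub, map_neg, mul_apply_eq_comp, haa,
      add_apply, sub_apply, neg_apply, mul_add, add_mul, mul_sub, sub_mul, mul_assoc, hpp,
      huu, hww, neg_mul, mul_neg, neg_neg]
    abel

/-- If `T^{0,2}_a = 0` at a point and its derivative in every horizontal direction vanishes (`h₁`,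
where `a'` is the velocity of `a` along a horizontal curve), then `[R, a]^{0,2}_a` satisfies the
algebraic Bianchi identity. This is the first Bianchi identity
`𝔖 R(X, Y) Z = 𝔖 ((∇_X T)(Y, Z) + T(T(X, Y), Z))`, applied to the arguments `X, Y, Z` with `a`
inserted in various places. -/
theorem cyclic_sum_antiPart_curvature (G : E →L[ℝ] E →L[ℝ] E)
    (D : E →L[ℝ] E →L[ℝ] E →L[ℝ] E) (a : E →L[ℝ] E) (ha : a * a = -1)
    (h₀ : ∀ Y Z, antiPart (localTorsion G) a a Y Z = 0)
    (h₁ : ∀ ξ Y Z, letI a' := -(G ξ * a - a * G ξ)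
      localTorsion (D ξ) (a Y) (a Z) + localTorsion G (a' Y) (a Z) + localTorsion G (a Y) (a' Z)
      - localTorsion (D ξ) Y Z
      - (a' (localTorsion G (a Y) Z) + a (localTorsion (D ξ) (a Y) Z + localTorsion G (a' Y) Z))
      - (a' (localTorsion G Y (a Z)) + a (localTorsion (D ξ) Y (a Z) + localTorsion G Y (a' Z)))
      = 0) (X Y Z : E) :
    letI Ω := antiPart (fun X Y ↦ localCurvature G D X Y * a - a * localCurvature G D X Y)
        a (a * ·)
    Ω X Y Z + Ω Y Z X + Ω Z X Y = 0 := by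
  have haa : ∀ v : E, a (a v) = -v := fun v ↦ by
    have := DFunLike.congr_fun ha v
    simpa using this
  -- the covariant derivative of the torsion
  let N : E → E → E → E := fun ξ Y Z ↦
    localTorsion (D ξ) Y Z + G ξ (localTorsion G Y Z) - localTorsion G (G ξ Y) Z
      - localTorsion G Y (G ξ Z)
  have hN : ∀ ξ Y Z, antiPart (N ξ) a a Y Z = 0 := fun ξ Y Z ↦ by
    have e₁ := h₁ ξ Y Z
    have e₂ := congrArg (G ξ) (h₀ Y Z)
    have e₃ := h₀ (G ξ Y) Z
    have e₄ := h₀ Y (G ξ Z)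
    simp only [N, antiPart, localTorsion, map_add, map_sub, map_neg, map_zero, mul_apply_eq_comp,
      sub_apply, neg_apply] at e₁ e₂ e₃ e₄ ⊢
    linear_combination (norm := module) e₁ + e₂ - e₃ - e₄
  -- the terms that are quadratic in the torsion: `P' = a P` by `h₀ X Y`, and the sum is then the
  -- image under `-a` of the expression in `h₀ P Z`
  have hT : ∀ X Y Z, letI P := localTorsion G X Y - localTorsion G (a X) (a Y)
      letI P' := localTorsion G (a X) Y + localTorsion G X (a Y)
      a (localTorsion G P Z) - localTorsion G P (a Z) - localTorsion G P' Z
        - a (localTorsion G P' (a Z)) = 0 := fun X Y Z ↦ by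
    have e : localTorsion G (a X) Y + localTorsion G X (a Y) =
        a (localTorsion G X Y - localTorsion G (a X) (a Y)) := by
      have := congrArg a (h₀ X Y)
      simp only [antiPart, map_sub, map_zero, haa] at this ⊢
      linear_combination (norm := module) this
    rw [e]
    generalize localTorsion G X Y - localTorsion G (a X) (a Y) = P
    have := congrArg a (h₀ P Z)
    simp only [antiPart, map_sub, map_zero, haa] at this ⊢
    linear_combination (norm := module) -this
  have e₁ := hN (a X) Y Z
  have e₂ := hN (a Y) Z X
  have e₃ := hN (a Z) X Y
  have f₁ := congrArg a (hN X Y Z)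
  have f₂ := congrArg a (hN Y Z X)
  have f₃ := congrArg a (hN Z X Y)
  have t₁ := hT X Y Z
  have t₂ := hT Y Z X
  have t₃ := hT Z X Y
  simp only [N, antiPart, localTorsion, localCurvature, map_add, map_sub, map_zero,
    mul_apply_eq_comp, haa, add_apply, sub_apply] at e₁ e₂ e₃ f₁ f₂ f₃ t₁ t₂ t₃ ⊢
  linear_combination (norm := abel) e₁ + e₂ + e₃ - f₁ - f₂ - f₃ + t₁ + t₂ + t₃

end LocalModel

/-! ### Quaternionic triples -/

section Quaternions

variable {A : Type*} [Ring A] [Algebra ℝ A] {J₁ J₂ J₃ : A}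

/-- The quaternionic relations. They imply `J₃ * J₃ = -1` and the remaining products. -/
structure IsQuaternionicTriple (J₁ J₂ J₃ : A) : Prop where
  sq₁ : J₁ * J₁ = -1
  sq₂ : J₂ * J₂ = -1
  mul₁₂ : J₁ * J₂ = J₃
  mul₂₁ : J₂ * J₁ = -J₃

namespace IsQuaternionicTriple

theorem mul_comb (h : IsQuaternionicTriple J₁ J₂ J₃) (x₁ x₂ x₃ y₁ y₂ y₃ : ℝ) :
    (x₁ • J₁ + x₂ • J₂ + x₃ • J₃) * (y₁ • J₁ + y₂ • J₂ + y₃ • J₃) =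
      (-(x₁ * y₁ + x₂ * y₂ + x₃ * y₃)) • (1 : A) +
      ((x₂ * y₃ - x₃ * y₂) • J₁ + (x₃ * y₁ - x₁ * y₃) • J₂ + (x₁ * y₂ - x₂ * y₁) • J₃) := by
  have h13 : J₁ * J₃ = -J₂ := by rw [← h.mul₁₂, ← mul_assoc, h.sq₁]; simp
  have h31 : J₃ * J₁ = J₂ := by
    rw [← neg_neg J₃, ← h.mul₂₁, neg_mul, mul_assoc, h.sq₁]; simp
  have h32 : J₃ * J₂ = -J₁ := by rw [← h.mul₁₂, mul_assoc, h.sq₂]; simp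
  have h23 : J₂ * J₃ = J₁ := by
    rw [← neg_neg J₃, ← h.mul₂₁, mul_neg, ← mul_assoc, h.sq₂]; simp
  have h33 : J₃ * J₃ = -1 := by
    nth_rw 1 [← h.mul₁₂]; rw [mul_assoc, h23, h.sq₁]
  simp only [mul_add, add_mul, smul_mul_assoc, mul_smul_comm, h.sq₁, h.sq₂, h.mul₁₂, h.mul₂₁,
    h13, h31, h32, h23, h33]
  module

theorem mul_mem_of_anticomm (h : IsQuaternionicTriple J₁ J₂ J₃) {x y : A}
    (hx : x ∈ Submodule.span ℝ {J₁, J₂, J₃}) (hy : y ∈ Submodule.span ℝ {J₁, J₂, J₃})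
    (hxy : y * x = -(x * y)) : x * y ∈ Submodule.span ℝ {J₁, J₂, J₃} := by
  obtain ⟨x₁, x₂, x₃, rfl⟩ := Submodule.mem_span_triple.mp hx
  obtain ⟨y₁, y₂, y₃, rfl⟩ := Submodule.mem_span_triple.mp hy
  rw [h.mul_comb, h.mul_comb] at hxy
  have e : (-(x₁ * y₁ + x₂ * y₂ + x₃ * y₃)) • (1 : A) = 0 := by
    linear_combination (norm := module) (1 / 2 : ℝ) • hxy
  rw [h.mul_comb, e, zero_add]
  exact Submodule.mem_span_triple.mpr ⟨_, _, _, rfl⟩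

/-- A nonzero imaginary quaternion is invertible: its square is a nonzero real multiple of `1`. -/
theorem exists_mul_self (h : IsQuaternionicTriple J₁ J₂ J₃) {x : A}
    (hx : x ∈ Submodule.span ℝ {J₁, J₂, J₃}) (hx0 : x ≠ 0) :
    ∃ r : ℝ, r ≠ 0 ∧ x * x = r • (1 : A) := by
  obtain ⟨x₁, x₂, x₃, rfl⟩ := Submodule.mem_span_triple.mp hx
  refine ⟨-(x₁ * x₁ + x₂ * x₂ + x₃ * x₃), fun h0 ↦ hx0 ?_, ?_⟩
  · have e₁ : x₁ = 0 := by nlinarith [mul_self_nonneg x₁, mul_self_nonneg x₂, mul_self_nonneg x₃]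
    have e₂ : x₂ = 0 := by nlinarith [mul_self_nonneg x₁, mul_self_nonneg x₂, mul_self_nonneg x₃]
    have e₃ : x₃ = 0 := by nlinarith [mul_self_nonneg x₁, mul_self_nonneg x₂, mul_self_nonneg x₃]
    simp [e₁, e₂, e₃]
  · rw [h.mul_comb]
    module

end IsQuaternionicTriple

variable {V : Type*} [NormedAddCommGroup V] [NormedSpace ℝ V]

/-- A 2-form with values in the imaginary quaternions that satisfies the algebraic Bianchi identity
vanishes in dimension greater than `6`: if `Ω X Y ≠ 0`, then `Ω X Y` is surjective, but its image
is spanned by the `Jᵢ X` and `Jᵢ Y`. -/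
theorem IsQuaternionicTriple.eq_zero_of_cyclic [FiniteDimensional ℝ V] (hV : 7 ≤ Module.finrank ℝ V)
    {J₁ J₂ J₃ : V →L[ℝ] V} (h : IsQuaternionicTriple J₁ J₂ J₃) (Ω : V → V → V →L[ℝ] V)
    (hΩ : ∀ X Y, Ω X Y ∈ Submodule.span ℝ {J₁, J₂, J₃})
    (hcyc : ∀ X Y Z, Ω X Y Z + Ω Y Z X + Ω Z X Y = 0) (X Y : V) : Ω X Y = 0 := by
  by_contra h0
  obtain ⟨r, hr, hsq⟩ := h.exists_mul_self (hΩ X Y) h0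
  let s : Finset V := by
    classical exact {J₁ X, J₂ X, J₃ X, J₁ Y, J₂ Y, J₃ Y}
  have hmem : ∀ B ∈ Submodule.span ℝ {J₁, J₂, J₃},
      B X ∈ Submodule.span ℝ (s : Set V) ∧ B Y ∈ Submodule.span ℝ (s : Set V) := by
    intro B hB
    obtain ⟨b₁, b₂, b₃, rfl⟩ := Submodule.mem_span_triple.mp hB
    have hs : ∀ v ∈ s, v ∈ Submodule.span ℝ (s : Set V) := fun v hv ↦ Submodule.subset_span hv
    constructor <;>
    · simp only [add_apply, smul_apply]
      refine add_mem (add_mem ?_ ?_) ?_ <;>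
      · refine Submodule.smul_mem _ _ (hs _ ?_)
        simp [s]
  have htop : Submodule.span ℝ (s : Set V) = ⊤ := by
    refine Submodule.eq_top_iff'.mpr fun Z ↦ ?_
    -- `Z` is the image under `Ω X Y` of a multiple of `Ω X Y Z`
    have e : Z = Ω X Y (r⁻¹ • Ω X Y Z) := by
      have := DFunLike.congr_fun hsq Z
      simp only [mul_apply_eq_comp, smul_apply, one_apply_eq_self] at this
      rw [map_smul, this, smul_smul, inv_mul_cancel₀ hr, one_smul]
    rw [e]
    have := hcyc X Y (r⁻¹ • Ω X Y Z)
    rw [add_assoc, add_eq_zero_iff_eq_neg] at this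
    rw [this]
    exact neg_mem (add_mem (hmem _ (hΩ _ _)).1 (hmem _ (hΩ _ _)).2)
  have hc := finrank_span_finset_le_card (R := ℝ) s
  rw [Set.finrank, htop, finrank_top] at hc
  have : s.card ≤ 6 := by classical exact Finset.card_le_six
  omega

end Quaternions

/-! ### Quaternionic connections on open subsets of a vector space -/

section LocalConnection

variable {E : Type*} [NormedAddCommGroup E] [NormedSpace ℝ E]

/-- On the open set `D`, the connection `d + Γ` preserves the bundle spanned by `J₁, J₂, J₃`, which
satisfy the quaternionic relations. The condition `preserves` is imposed on sections that are
defined near a point. -/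
structure IsLocalQuaternionicConnection (D : Set E) (Γ : E → E →L[ℝ] E →L[ℝ] E)
    (J₁ J₂ J₃ : E → E →L[ℝ] E) : Prop where
  isOpen : IsOpen D
  contDiffOn : ContDiffOn ℝ ∞ Γ D
  contDiffOn₁ : ContDiffOn ℝ ∞ J₁ D
  contDiffOn₂ : ContDiffOn ℝ ∞ J₂ D
  contDiffOn₃ : ContDiffOn ℝ ∞ J₃ D
  triple : ∀ x ∈ D, IsQuaternionicTriple (J₁ x) (J₂ x) (J₃ x)
  preserves : ∀ s : E → E →L[ℝ] E, ∀ x ∈ D,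
    (∀ᶠ y in 𝓝 x, ContDiffAt ℝ ∞ s y ∧ s y ∈ Submodule.span ℝ {J₁ y, J₂ y, J₃ y}) → ∀ ξ,
    fderiv ℝ s x ξ + (Γ x ξ * s x - s x * Γ x ξ) ∈ Submodule.span ℝ {J₁ x, J₂ x, J₃ x}

/-- The twistor space of the bundle spanned by `J₁, J₂, J₃` over `D`. -/
def localTwistorSpace (D : Set E) (J₁ J₂ J₃ : E → E →L[ℝ] E) : Set (E × (E →L[ℝ] E)) :=
  {p | p.1 ∈ D ∧ p.2 ∈ Submodule.span ℝ {J₁ p.1, J₂ p.1, J₃ p.1} ∧ p.2 * p.2 = -1}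

namespace IsLocalQuaternionicConnection

variable {D : Set E} {Γ : E → E →L[ℝ] E →L[ℝ] E} {J₁ J₂ J₃ : E → E →L[ℝ] E}

theorem contDiffAt_comb (h : IsLocalQuaternionicConnection D Γ J₁ J₂ J₃) (c₁ c₂ c₃ : ℝ) {x : E}
    (hx : x ∈ D) : ContDiffAt ℝ ∞ (fun y ↦ c₁ • J₁ y + c₂ • J₂ y + c₃ • J₃ y) x := by
  have hn := h.isOpen.mem_nhds hx
  have h₁ := h.contDiffOn₁.contDiffAt hn
  have h₂ := h.contDiffOn₂.contDiffAt hn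
  have h₃ := h.contDiffOn₃.contDiffAt hn
  exact ((h₁.const_smul c₁).add (h₂.const_smul c₂)).add (h₃.const_smul c₃)

theorem comb_mem (c₁ c₂ c₃ : ℝ) (y : E) : c₁ • J₁ y + c₂ • J₂ y + c₃ • J₃ y ∈
    Submodule.span ℝ {J₁ y, J₂ y, J₃ y} :=
  Submodule.mem_span_triple.mpr ⟨_, _, _, rfl⟩

set_option synthInstance.maxHeartbeats 200000 in
/-- The curvature acts on sections of `Q` as the commutator of second covariant derivatives, hence
it preserves `Q`. -/
theorem curvature_mem (h : IsLocalQuaternionicConnection D Γ J₁ J₂ J₃) {x : E} (hx : x ∈ D)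
    {a : E →L[ℝ] E} (ha : a ∈ Submodule.span ℝ {J₁ x, J₂ x, J₃ x}) (X Y : E) :
    localCurvature (Γ x) (fderiv ℝ Γ x) X Y * a - a * localCurvature (Γ x) (fderiv ℝ Γ x) X Y ∈
      Submodule.span ℝ {J₁ x, J₂ x, J₃ x} := by
  obtain ⟨c₁, c₂, c₃, rfl⟩ := Submodule.mem_span_triple.mp ha
  set s : E → E →L[ℝ] E := fun y ↦ c₁ • J₁ y + c₂ • J₂ y + c₃ • J₃ y with hs
  have hsD : ∀ y ∈ D, ContDiffAt ℝ ∞ s y := fun y hy ↦ h.contDiffAt_comb c₁ c₂ c₃ hy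
  have hn := h.isOpen.mem_nhds hx
  have hΓ : ContDiffAt ℝ ∞ Γ x := h.contDiffOn.contDiffAt hn
  have hds : ContDiffAt ℝ ∞ (fderiv ℝ s) x := (hsD x hx).fderiv_right le_rfl
  have hev : ∀ y ∈ D, ∀ᶠ z in 𝓝 y, ContDiffAt ℝ ∞ s z ∧
      s z ∈ Submodule.span ℝ {J₁ z, J₂ z, J₃ z} := fun y hy ↦ by
    filter_upwards [h.isOpen.mem_nhds hy] with z hz
    exact ⟨hsD z hz, comb_mem c₁ c₂ c₃ z⟩
  -- `τ Y` is the covariant derivative of `s` in the constant direction `Y`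
  let τ : E → E → E →L[ℝ] E := fun Y y ↦ fderiv ℝ s y Y + (Γ y Y * s y - s y * Γ y Y)
  have hτm : ∀ Y, ∀ᶠ y in 𝓝 x, τ Y y ∈ Submodule.span ℝ {J₁ y, J₂ y, J₃ y} := fun Y ↦ by
    filter_upwards [hn] with y hy
    exact h.preserves s y hy (hev y hy) Y
  have hτsD : ∀ Y, ∀ y ∈ D, ContDiffAt ℝ ∞ (τ Y) y := fun Y y hy ↦ by
    have h1 : ContDiffAt ℝ ∞ (fun y ↦ fderiv ℝ s y Y) y :=
      ((hsD y hy).fderiv_right le_rfl).clm_apply contDiffAt_const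
    have h2 : ContDiffAt ℝ ∞ (fun y ↦ Γ y Y) y :=
      (h.contDiffOn.contDiffAt (h.isOpen.mem_nhds hy)).clm_apply contDiffAt_const
    exact h1.add ((h2.mul (hsD y hy)).sub ((hsD y hy).mul h2))
  have hτs : ∀ Y, ContDiffAt ℝ ∞ (τ Y) x := fun Y ↦ hτsD Y x hx
  have hτd : ∀ X Y, fderiv ℝ (τ Y) x X = fderiv ℝ (fderiv ℝ s) x X Y +
      ((fderiv ℝ Γ x X Y * s x + Γ x Y * fderiv ℝ s x X) -
        (fderiv ℝ s x X * Γ x Y + s x * fderiv ℝ Γ x X Y)) := fun X Y ↦ by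
    have hl : HasDerivAt (fun t : ℝ ↦ x + t • X) X 0 := by
      simpa using ((hasDerivAt_id (0 : ℝ)).smul_const X).const_add x
    have hl0 : x + (0 : ℝ) • X = x := by simp
    have k1 : HasDerivAt (fun t : ℝ ↦ fderiv ℝ s (x + t • X)) (fderiv ℝ (fderiv ℝ s) x X) 0 :=
      HasFDerivAt.comp_hasDerivAt_of_eq (l := fderiv ℝ s) 0
        ((hds.differentiableAt (by simp)).hasFDerivAt) hl hl0.symm
    have k2 : HasDerivAt (fun t : ℝ ↦ Γ (x + t • X)) (fderiv ℝ Γ x X) 0 :=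
      HasFDerivAt.comp_hasDerivAt_of_eq (l := Γ) 0
        ((hΓ.differentiableAt (by simp)).hasFDerivAt) hl hl0.symm
    have k3 : HasDerivAt (fun t : ℝ ↦ s (x + t • X)) (fderiv ℝ s x X) 0 :=
      HasFDerivAt.comp_hasDerivAt_of_eq (l := s) 0
        (((hsD x hx).differentiableAt (by simp)).hasFDerivAt) hl hl0.symm
    have k4 : HasDerivAt (fun t : ℝ ↦ τ Y (x + t • X)) (fderiv ℝ (τ Y) x X) 0 :=
      HasFDerivAt.comp_hasDerivAt_of_eq (l := τ Y) 0
        (((hτs Y).differentiableAt (by simp)).hasFDerivAt) hl hl0.symm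
    have k5 := k1.clm_apply (hasDerivAt_const 0 Y)
    have k6 := k2.clm_apply (hasDerivAt_const 0 Y)
    have k7 := k5.add ((k6.mul k3).sub (k3.mul k6))
    have := k4.unique k7
    simpa only [map_zero, add_zero, hl0] using this
  have hsymm : fderiv ℝ (fderiv ℝ s) x X Y = fderiv ℝ (fderiv ℝ s) x Y X :=
    ((hsD x hx).isSymmSndFDerivAt (by
      rw [minSmoothness_of_isRCLikeNormedField]
      exact WithTop.coe_le_coe.2 (le_top : (2 : ℕ∞) ≤ ⊤))).eq X Y
  have hτev : ∀ Y, ∀ᶠ y in 𝓝 x, ContDiffAt ℝ ∞ (τ Y) y ∧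
      τ Y y ∈ Submodule.span ℝ {J₁ y, J₂ y, J₃ y} := fun Y ↦ by
    filter_upwards [hn, hτm Y] with y hy hy'
    exact ⟨hτsD Y y hy, hy'⟩
  have m₁ := h.preserves (τ Y) x hx (hτev Y) X
  have m₂ := h.preserves (τ X) x hx (hτev X) Y
  have m := sub_mem m₁ m₂
  rw [hτd, hτd, hsymm] at m
  convert m using 1
  simp only [τ, localCurvature]
  change _ * s x - s x * _ = _
  noncomm_ring

/-- Horizontal vectors are tangent to the twistor space. The curve is obtained from a section `s` of
`Q` with constant coefficients by rotating `s` against its covariant derivative, so no parallel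
transport is needed. -/
theorem exists_horizontal_curve (h : IsLocalQuaternionicConnection D Γ J₁ J₂ J₃)
    {p : E × (E →L[ℝ] E)} (hp : p ∈ localTwistorSpace D J₁ J₂ J₃) (ξ : E) :
    ∃ γ : ℝ → E × (E →L[ℝ] E), γ 0 = p ∧ (∀ᶠ t in 𝓝 0, γ t ∈ localTwistorSpace D J₁ J₂ J₃) ∧
      ContDiffAt ℝ ∞ γ 0 ∧ HasDerivAt γ (ξ, -(Γ p.1 ξ * p.2 - p.2 * Γ p.1 ξ)) 0 := by
  obtain ⟨x, a⟩ := p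
  obtain ⟨hx, ha, haa⟩ := hp
  simp only at hx ha haa ⊢
  obtain ⟨c₁, c₂, c₃, hc⟩ := Submodule.mem_span_triple.mp ha
  set s : E → E →L[ℝ] E := fun y ↦ c₁ • J₁ y + c₂ • J₂ y + c₃ • J₃ y with hs
  have hsx : s x = a := hc
  have hsD : ∀ y ∈ D, ContDiffAt ℝ ∞ s y := fun y hy ↦ h.contDiffAt_comb c₁ c₂ c₃ hy
  have hev : ∀ᶠ z in 𝓝 x, ContDiffAt ℝ ∞ s z ∧
      s z ∈ Submodule.span ℝ {J₁ z, J₂ z, J₃ z} := by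
    filter_upwards [h.isOpen.mem_nhds hx] with z hz
    exact ⟨hsD z hz, comb_mem c₁ c₂ c₃ z⟩
  have hb := h.preserves s x hx hev ξ
  obtain ⟨b₁, b₂, b₃, hb⟩ := Submodule.mem_span_triple.mp hb
  set B : E → E →L[ℝ] E := fun y ↦ b₁ • J₁ y + b₂ • J₂ y + b₃ • J₃ y with hB
  have hBD : ∀ y ∈ D, ContDiffAt ℝ ∞ B y := fun y hy ↦ h.contDiffAt_comb b₁ b₂ b₃ hy
  set β : ℝ := b₁ * b₁ + b₂ * b₂ + b₃ * b₃ with hβ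
  have hβ0 : 0 ≤ β :=
    add_nonneg (add_nonneg (mul_self_nonneg _) (mul_self_nonneg _)) (mul_self_nonneg _)
  have hs2 : ∀ y ∈ D, s y * s y = -((c₁ * c₁ + c₂ * c₂ + c₃ * c₃) • (1 : E →L[ℝ] E)) :=
    fun y hy ↦ by
      simp only [hs]
      rw [(h.triple y hy).mul_comb]
      module
  have hs3 : (c₁ * c₁ + c₂ * c₂ + c₃ * c₃) • (1 : E →L[ℝ] E) = 1 := by
    have := hs2 x hx
    rw [hsx, haa] at this
    exact (neg_injective this).symm
  have hB2 : ∀ y ∈ D, B y * B y = -(β • (1 : E →L[ℝ] E)) := fun y hy ↦ by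
    simp only [hB, hβ]
    rw [(h.triple y hy).mul_comb]
    module
  have hsB : ∀ y ∈ D, s y * B y + B y * s y =
      -((2 * (c₁ * b₁ + c₂ * b₂ + c₃ * b₃)) • (1 : E →L[ℝ] E)) := fun y hy ↦ by
    simp only [hB, hs]
    rw [(h.triple y hy).mul_comb, (h.triple y hy).mul_comb]
    module
  -- the covariant derivative `B x` of `s` anticommutes with `s x` because `s ^ 2` is constant
  have hsB0 : (2 * (c₁ * b₁ + c₂ * b₂ + c₃ * b₃)) • (1 : E →L[ℝ] E) = 0 := by
    have hl : HasDerivAt (fun t : ℝ ↦ x + t • ξ) ξ 0 := by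
      simpa using ((hasDerivAt_id (0 : ℝ)).smul_const ξ).const_add x
    have k : HasDerivAt (fun t : ℝ ↦ s (x + t • ξ)) (fderiv ℝ s x ξ) 0 :=
      HasFDerivAt.comp_hasDerivAt_of_eq (l := s) 0
        (((hsD x hx).differentiableAt (by simp)).hasFDerivAt) hl (by simp)
    have hlD : ∀ᶠ t : ℝ in 𝓝 0, x + t • ξ ∈ D :=
      hl.continuousAt.preimage_mem_nhds (h.isOpen.mem_nhds (by simpa using hx))
    have k2 : HasDerivAt (fun t : ℝ ↦ s (x + t • ξ) * s (x + t • ξ)) 0 0 := by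
      refine (hasDerivAt_const (0 : ℝ) (-1 : E →L[ℝ] E)).congr_of_eventuallyEq ?_
      filter_upwards [hlD] with t ht
      rw [hs2 _ ht, hs3]
    have k3 := (k.mul k).unique k2
    simp only [zero_smul, add_zero, hsx] at k3
    have k4 := hsB x hx
    have k5 : s x * B x + B x * s x = 0 := by
      simp only [hB]
      rw [hb, hsx, ← k3]
      simp only [mul_add, add_mul, mul_sub, sub_mul, ← mul_assoc, haa]
      simp only [mul_assoc, haa]
      noncomm_ring
    rw [k5] at k4
    exact neg_eq_zero.mp k4.symm
  -- the rational parametrization of the circle through `s` in the direction of `-B`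
  let f : ℝ → ℝ := fun t ↦ (1 - β / 4 * t ^ 2) / (1 + β / 4 * t ^ 2)
  let g : ℝ → ℝ := fun t ↦ t / (1 + β / 4 * t ^ 2)
  have hpos : ∀ t : ℝ, 1 + β / 4 * t ^ 2 ≠ 0 := fun t ↦ by positivity
  have hfg : ∀ t, f t * f t + g t * g t * β = 1 := fun t ↦ by
    have := hpos t
    simp only [f, g]
    field_simp
    ring
  have hfs : ContDiff ℝ ∞ f := by
    refine ContDiff.div (by fun_prop) (by fun_prop) hpos
  have hgs : ContDiff ℝ ∞ g := by
    refine ContDiff.div (by fun_prop) (by fun_prop) hpos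
  have hq : HasDerivAt (fun t : ℝ ↦ β / 4 * t ^ 2) 0 0 := by
    simpa using ((hasDerivAt_id (0 : ℝ)).pow 2).const_mul (β / 4)
  have hf' : HasDerivAt f 0 0 := by
    exact ((hq.const_sub 1).div (hq.const_add 1) (hpos 0)).congr_deriv (by simp)
  have hg' : HasDerivAt g 1 0 := by
    exact ((hasDerivAt_id (0 : ℝ)).div (hq.const_add 1) (hpos 0)).congr_deriv (by simp)
  have hf0 : f 0 = 1 := by simp [f]
  have hg0 : g 0 = 0 := by simp [g]
  have hl : HasDerivAt (fun t : ℝ ↦ x + t • ξ) ξ 0 := by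
    simpa using ((hasDerivAt_id (0 : ℝ)).smul_const ξ).const_add x
  have hls : ContDiffAt ℝ ∞ (fun t : ℝ ↦ x + t • ξ) 0 := by fun_prop
  have hl0 : x + (0 : ℝ) • ξ = x := by simp
  have hlD : ∀ᶠ t : ℝ in 𝓝 0, x + t • ξ ∈ D :=
    hl.continuousAt.preimage_mem_nhds (h.isOpen.mem_nhds (by simpa using hx))
  refine ⟨fun t ↦ (x + t • ξ, f t • s (x + t • ξ) - g t • B (x + t • ξ)), ?_, ?_, ?_, ?_⟩
  · simp [hf0, hg0, hsx]
  · filter_upwards [hlD] with t ht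
    refine ⟨ht, sub_mem (Submodule.smul_mem _ _ (comb_mem _ _ _ _))
      (Submodule.smul_mem _ _ (comb_mem _ _ _ _)), ?_⟩
    have e₁ := hs2 _ ht
    have e₂ := hB2 _ ht
    have e₃ := hsB _ ht
    rw [hs3] at e₁
    rw [hsB0, neg_zero] at e₃
    have e₄ : (f t * f t + g t * g t * β) • (1 : E →L[ℝ] E) = (1 : ℝ) • 1 := by rw [hfg]
    change (f t • s (x + t • ξ) - g t • B (x + t • ξ)) *
      (f t • s (x + t • ξ) - g t • B (x + t • ξ)) = -1
    simp only [mul_sub, sub_mul, smul_mul_assoc, mul_smul_comm]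
    linear_combination (norm := module) (f t * f t) • e₁ + (g t * g t) • e₂ - (f t * g t) • e₃ - e₄
  · have k1 : ContDiffAt ℝ ∞ (fun t : ℝ ↦ s (x + t • ξ)) 0 :=
      ContDiffAt.comp (g := s) 0 (by rw [hl0]; exact hsD x hx) hls
    have k2 : ContDiffAt ℝ ∞ (fun t : ℝ ↦ B (x + t • ξ)) 0 :=
      ContDiffAt.comp (g := B) 0 (by rw [hl0]; exact hBD x hx) hls
    exact hls.prodMk ((hfs.contDiffAt.smul k1).sub (hgs.contDiffAt.smul k2))
  · have k1 : HasDerivAt (fun t : ℝ ↦ s (x + t • ξ)) (fderiv ℝ s x ξ) 0 :=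
      HasFDerivAt.comp_hasDerivAt_of_eq (l := s) 0
        (((hsD x hx).differentiableAt (by simp)).hasFDerivAt) hl hl0.symm
    have k2 : HasDerivAt (fun t : ℝ ↦ B (x + t • ξ)) (fderiv ℝ B x ξ) 0 :=
      HasFDerivAt.comp_hasDerivAt_of_eq (l := B) 0
        (((hBD x hx).differentiableAt (by simp)).hasFDerivAt) hl hl0.symm
    have k3 := hl.prodMk ((hf'.smul k1).sub (hg'.smul k2))
    refine HasDerivAt.congr_deriv k3 (Prod.ext rfl ?_)
    have : B x = fderiv ℝ s x ξ + (Γ x ξ * s x - s x * Γ x ξ) := hb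
    simp only [hf0, hg0, one_smul, zero_smul, add_zero, zero_add]
    rw [this, hsx]
    abel

/-- The equation `T^{0,2}_a = 0` differentiated along a horizontal curve in the twistor space. -/
theorem torsion_deriv (h : IsLocalQuaternionicConnection D Γ J₁ J₂ J₃)
    (hT : ∀ q ∈ localTwistorSpace D J₁ J₂ J₃, ∀ Y Z,
      antiPart (localTorsion (Γ q.1)) q.2 q.2 Y Z = 0)
    {p : E × (E →L[ℝ] E)} (hp : p ∈ localTwistorSpace D J₁ J₂ J₃) (ξ Y Z : E) :
    letI G := Γ p.1
    letI D := fderiv ℝ Γ p.1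
    letI a := p.2
    letI a' := -(G ξ * a - a * G ξ)
    localTorsion (D ξ) (a Y) (a Z) + localTorsion G (a' Y) (a Z) + localTorsion G (a Y) (a' Z)
      - localTorsion (D ξ) Y Z
      - (a' (localTorsion G (a Y) Z) + a (localTorsion (D ξ) (a Y) Z + localTorsion G (a' Y) Z))
      - (a' (localTorsion G Y (a Z)) + a (localTorsion (D ξ) Y (a Z) + localTorsion G Y (a' Z)))
      = 0 := by
  obtain ⟨γ, hγ0, hγ, -, hγ'⟩ := h.exists_horizontal_curve hp ξ
  have hx : HasDerivAt (fun t ↦ (γ t).1) ξ 0 := hγ'.fst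
  have ha : HasDerivAt (fun t ↦ (γ t).2) (-(Γ p.1 ξ * p.2 - p.2 * Γ p.1 ξ)) 0 := hγ'.snd
  have hΓ : DifferentiableAt ℝ Γ p.1 :=
    (h.contDiffOn.contDiffAt (h.isOpen.mem_nhds hp.1)).differentiableAt (by simp)
  have hG : HasDerivAt (fun t ↦ Γ (γ t).1) (fderiv ℝ Γ p.1 ξ) 0 :=
    HasFDerivAt.comp_hasDerivAt_of_eq (l := Γ) 0 hΓ.hasFDerivAt hx (by rw [hγ0])
  have key : ∀ {V W : ℝ → E} {V' W' : E}, HasDerivAt V V' 0 → HasDerivAt W W' 0 →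
      HasDerivAt (fun t ↦ localTorsion (Γ (γ t).1) (V t) (W t))
        (localTorsion (fderiv ℝ Γ p.1 ξ) (V 0) (W 0) + localTorsion (Γ p.1) V' (W 0) +
          localTorsion (Γ p.1) (V 0) W') 0 := by
    intro V W V' W' hV hW
    have := ((hG.clm_apply hV).clm_apply hW).sub ((hG.clm_apply hW).clm_apply hV)
    refine HasDerivAt.congr_deriv this ?_
    simp only [localTorsion, hγ0, add_apply]
    abel
  have cY := hasDerivAt_const (0 : ℝ) Y
  have cZ := hasDerivAt_const (0 : ℝ) Z
  have aY := ha.clm_apply cY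
  have aZ := ha.clm_apply cZ
  have k := (((key aY aZ).sub (key cY cZ)).sub (ha.clm_apply (key aY cZ))).sub
    (ha.clm_apply (key cY aZ))
  have k0 : HasDerivAt (fun t ↦ antiPart (localTorsion (Γ (γ t).1)) (γ t).2 (γ t).2 Y Z) 0 0 := by
    refine (hasDerivAt_const (0 : ℝ) (0 : E)).congr_of_eventuallyEq ?_
    filter_upwards [hγ] with t ht
    exact hT _ ht Y Z
  have := k.unique k0
  rw [← this]
  simp only [hγ0, map_zero, add_zero, localTorsion, zero_apply, sub_zero]

/-- If `T^{0,2}_a = 0` on the twistor space, then `[R, a]^{0,2}_a = 0` as well. -/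
theorem antiPart_curvature_eq_zero [FiniteDimensional ℝ E] (hE : 7 ≤ Module.finrank ℝ E)
    (h : IsLocalQuaternionicConnection D Γ J₁ J₂ J₃)
    (hT : ∀ q ∈ localTwistorSpace D J₁ J₂ J₃, ∀ Y Z,
      antiPart (localTorsion (Γ q.1)) q.2 q.2 Y Z = 0)
    {p : E × (E →L[ℝ] E)} (hp : p ∈ localTwistorSpace D J₁ J₂ J₃) (X Y : E) :
    antiPart (fun X Y ↦ localCurvature (Γ p.1) (fderiv ℝ Γ p.1) X Y * p.2
      - p.2 * localCurvature (Γ p.1) (fderiv ℝ Γ p.1) X Y) p.2 (p.2 * ·) X Y = 0 := by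
  refine (h.triple p.1 hp.1).eq_zero_of_cyclic hE
    (antiPart (fun X Y ↦ localCurvature (Γ p.1) (fderiv ℝ Γ p.1) X Y * p.2
      - p.2 * localCurvature (Γ p.1) (fderiv ℝ Γ p.1) X Y) p.2 (p.2 * ·)) ?_ ?_ X Y
  · intro X Y
    have hR := h.curvature_mem hp.1 hp.2.1
    have hpR : ∀ X Y, p.2 * (localCurvature (Γ p.1) (fderiv ℝ Γ p.1) X Y * p.2
        - p.2 * localCurvature (Γ p.1) (fderiv ℝ Γ p.1) X Y) ∈
        Submodule.span ℝ {J₁ p.1, J₂ p.1, J₃ p.1} := fun X Y ↦ by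
      refine (h.triple p.1 hp.1).mul_mem_of_anticomm hp.2.1 (hR X Y) ?_
      have e := hp.2.2
      rw [sub_mul, mul_sub, mul_assoc, e, ← mul_assoc p.2 p.2, e]
      noncomm_ring
    exact sub_mem (sub_mem (sub_mem (hR _ _) (hR _ _)) (hpR _ _)) (hpR _ _)
  · exact cyclic_sum_antiPart_curvature _ _ _ hp.2.2 (hT p hp) fun ξ Y Z ↦
      h.torsion_deriv hT hp ξ Y Z

/-- The Nijenhuis tensor of `localTwistorI` on the twistor space. The fields `U`, `W`, `U'`, `W'`
are defined on the ambient space, but the relations `U' = I U` and `W' = I W` are known only on the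
twistor space. This suffices because the four vectors at `p` are velocities of curves in it. -/
theorem nijenhuis_eq (h : IsLocalQuaternionicConnection D Γ J₁ J₂ J₃)
    {p : E × (E →L[ℝ] E)} (hp : p ∈ localTwistorSpace D J₁ J₂ J₃)
    {U W U' W' : E × (E →L[ℝ] E) → E × (E →L[ℝ] E)}
    (hU : DifferentiableAt ℝ U p) (hW : DifferentiableAt ℝ W p)
    (hU' : DifferentiableAt ℝ U' p) (hW' : DifferentiableAt ℝ W' p)
    (hI : ∀ᶠ q in 𝓝 p, q ∈ localTwistorSpace D J₁ J₂ J₃ →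
      U' q = localTwistorI (Γ q.1) q.2 (U q) ∧ W' q = localTwistorI (Γ q.1) q.2 (W q))
    (hcurve : ∀ v ∈ ({U p, W p, U' p, W' p} : Set (E × (E →L[ℝ] E))),
      ∃ γ : ℝ → E × (E →L[ℝ] E), γ 0 = p ∧ (∀ᶠ t in 𝓝 0, γ t ∈ localTwistorSpace D J₁ J₂ J₃) ∧
        HasDerivAt γ v 0) :
    letI N₁ := - antiPart (localTorsion (Γ p.1)) p.2 p.2 (U p).1 (W p).1
    VectorField.lieBracket ℝ U' W' p - VectorField.lieBracket ℝ U W p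
      - localTwistorI (Γ p.1) p.2 (VectorField.lieBracket ℝ U' W p)
      - localTwistorI (Γ p.1) p.2 (VectorField.lieBracket ℝ U W' p) =
    (N₁, -(Γ p.1 N₁ * p.2 - p.2 * Γ p.1 N₁)
      - antiPart (fun X Y ↦ localCurvature (Γ p.1) (fderiv ℝ Γ p.1) X Y * p.2
        - p.2 * localCurvature (Γ p.1) (fderiv ℝ Γ p.1) X Y) p.2 (p.2 * ·) (U p).1 (W p).1) := by
  have hΓ : DifferentiableAt ℝ Γ p.1 :=
    (h.contDiffOn.contDiffAt (h.isOpen.mem_nhds hp.1)).differentiableAt (by simp)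
  -- along curves in the twistor space, `V' = I V` may be differentiated
  have key : ∀ V V' : E × (E →L[ℝ] E) → E × (E →L[ℝ] E), DifferentiableAt ℝ V p →
      DifferentiableAt ℝ V' p → (∀ᶠ q in 𝓝 p, q ∈ localTwistorSpace D J₁ J₂ J₃ →
        V' q = localTwistorI (Γ q.1) q.2 (V q)) →
      ∀ v ∈ ({U p, W p, U' p, W' p} : Set (E × (E →L[ℝ] E))),
      fderiv ℝ V' p v =
        localTwistorIDeriv (Γ p.1) (fderiv ℝ Γ p.1) p.2 (V p) v (fderiv ℝ V p v) := by
    intro V V' hV hV' hVV' v hv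
    obtain ⟨γ, hγ0, hγ, hγ'⟩ := hcurve v hv
    have k1 : HasDerivAt (fun t ↦ V' (γ t)) (fderiv ℝ V' p v) 0 :=
      HasFDerivAt.comp_hasDerivAt_of_eq 0 hV'.hasFDerivAt hγ' hγ0.symm
    have k2 : HasDerivAt (fun t ↦ V (γ t)) (fderiv ℝ V p v) 0 :=
      HasFDerivAt.comp_hasDerivAt_of_eq 0 hV.hasFDerivAt hγ' hγ0.symm
    have k3 := HasDerivAt.localTwistorI (Γ := Γ) (by rw [hγ0]; exact hΓ) hγ' k2
    rw [hγ0] at k3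
    refine k1.unique (k3.congr_of_eventuallyEq ?_)
    have hγc : Filter.Tendsto γ (𝓝 0) (𝓝 p) := hγ0 ▸ hγ'.continuousAt
    filter_upwards [hγ, hγc.eventually hVV'] with t ht ht'
    exact ht' ht
  -- vectors tangent to `{a * a = -1}` anticommute with `a`
  have anti : ∀ v ∈ ({U p, W p, U' p, W' p} : Set (E × (E →L[ℝ] E))),
      v.2 * p.2 = -(p.2 * v.2) := by
    intro v hv
    obtain ⟨γ, hγ0, hγ, hγ'⟩ := hcurve v hv
    have ha : HasDerivAt (fun t ↦ (γ t).2) v.2 0 := hγ'.snd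
    have k0 : HasDerivAt (fun t ↦ (γ t).2 * (γ t).2) 0 0 := by
      refine (hasDerivAt_const (0 : ℝ) (-1 : E →L[ℝ] E)).congr_of_eventuallyEq ?_
      filter_upwards [hγ] with t ht
      exact ht.2.2
    have := (ha.mul ha).unique k0
    rw [hγ0] at this
    exact eq_neg_of_add_eq_zero_left this
  have hIU := hI.mono fun q hq hq' ↦ (hq hq').1
  have hIW := hI.mono fun q hq hq' ↦ (hq hq').2
  have e := nijenhuis_algebra (Γ p.1) (fderiv ℝ Γ p.1) p.2 (U p) (W p) (fderiv ℝ W p (U' p))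
    (fderiv ℝ U p (W' p)) (fderiv ℝ W p (U p)) (fderiv ℝ U p (W p)) hp.2.2
    (anti _ (by simp)) (anti _ (by simp))
  refine Eq.trans ?_ e
  simp only [VectorField.lieBracket]
  rw [key W W' hW hW' hIW (U' p) (by simp), key U U' hU hU' hIU (W' p) (by simp),
    key W W' hW hW' hIW (U p) (by simp), key U U' hU hU' hIU (W p) (by simp),
    (hI.self_of_nhds hp).1, (hI.self_of_nhds hp).2]

end IsLocalQuaternionicConnection

end LocalConnection

/-! ### Coordinates on the tangent bundle and on the endomorphism bundle -/

section Coordinates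

variable {E : Type*} [NormedAddCommGroup E] [NormedSpace ℝ E]
  {M : Type*} [TopologicalSpace M] [ChartedSpace E M] [IsManifold 𝓘(ℝ, E) ∞ M]

/-- The coordinates of tangent vectors at `y` in the chart at `x₀`. For `y` outside the source of
the chart the map is `0`. -/
noncomputable def toCoord (x₀ y : M) : TangentSpace 𝓘(ℝ, E) y →L[ℝ] E :=
  (trivializationAt E (TangentSpace 𝓘(ℝ, E) : M → Type _) x₀).continuousLinearMapAt ℝ y

/-- The tangent vector at `y` with given coordinates in the chart at `x₀`. -/
noncomputable def ofCoord (x₀ y : M) : E →L[ℝ] TangentSpace 𝓘(ℝ, E) y :=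
  (trivializationAt E (TangentSpace 𝓘(ℝ, E) : M → Type _) x₀).symmL ℝ y

variable {x₀ y : M}

theorem toCoord_ofCoord (hy : y ∈ (chartAt E x₀).source) (v : E) :
    toCoord x₀ y (ofCoord x₀ y v) = v :=
  (trivializationAt E (TangentSpace 𝓘(ℝ, E) : M → Type _) x₀).continuousLinearMapAt_symmL
    (R := ℝ) hy v

theorem trivializationAt_ofCoord (hy : y ∈ (chartAt E x₀).source) (v : E) :
    (trivializationAt E (TangentSpace 𝓘(ℝ, E) : M → Type _) x₀ ⟨y, ofCoord x₀ y v⟩).2 = v :=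
  (((trivializationAt E (TangentSpace 𝓘(ℝ, E) : M → Type _)
    x₀).continuousLinearMapAt_apply_of_mem ℝ hy _).symm).trans (toCoord_ofCoord hy v)

theorem ofCoord_toCoord (hy : y ∈ (chartAt E x₀).source) (v : TangentSpace 𝓘(ℝ, E) y) :
    ofCoord x₀ y (toCoord x₀ y v) = v :=
  (trivializationAt E (TangentSpace 𝓘(ℝ, E) : M → Type _) x₀).symmL_continuousLinearMapAt
    (R := ℝ) hy v

theorem toCoord_eq_mfderiv (hy : y ∈ (chartAt E x₀).source) :
    toCoord x₀ y = mfderiv 𝓘(ℝ, E) 𝓘(ℝ, E) (extChartAt 𝓘(ℝ, E) x₀) y :=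
  TangentBundle.continuousLinearMapAt_trivializationAt hy

/-- The matrix of an endomorphism of the tangent space at `y` in the chart at `x₀`. -/
noncomputable def endCoord (x₀ y : M) (B : EndFiber E M y) : E →L[ℝ] E :=
  toCoord x₀ y ∘L B ∘L ofCoord x₀ y

theorem trivializationAt_end_apply (x₀ : M) (A : EndTotal E M) :
    trivializationAt (E →L[ℝ] E) (EndFiber E M) x₀ A = (A.1, endCoord x₀ A.1 A.2) :=
  hom_trivializationAt_apply (RingHom.id ℝ) x₀ A

/-- The coordinates on `End(TM)` induced by the chart at `x₀`. They form the preferred chart at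
every point over `x₀`, see `extChartAt_end`. -/
noncomputable def endChart (x₀ : M) (A : EndTotal E M) : E × (E →L[ℝ] E) :=
  (extChartAt 𝓘(ℝ, E) x₀ A.1, endCoord x₀ A.1 A.2)

theorem extChartAt_end (A₀ A : EndTotal E M) :
    extChartAt (endModel E) A₀ A = endChart A₀.1 A := by
  have : chartAt (ModelProd E (E →L[ℝ] E)) A₀ A = (chartAt E A₀.1 A.1, endCoord A₀.1 A.1 A.2) :=
    hom_chart A₀ A
  rw [extChartAt_coe]
  simp only [Function.comp_apply, this]
  rfl

theorem extChartAt_end_source (A₀ : EndTotal E M) :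
    (extChartAt (endModel E) A₀).source = {A | A.1 ∈ (chartAt E A₀.1).source} := by
  rw [extChartAt_source, FiberBundle.chartedSpace_chartAt]
  ext A
  simp only [mfld_simps]
  exact ⟨fun h ↦ h.1, fun h ↦ ⟨h, h⟩⟩

theorem endCoord_comp (hy : y ∈ (chartAt E x₀).source) (A B : EndFiber E M y) :
    endCoord x₀ y (A ∘L B) = endCoord x₀ y A * endCoord x₀ y B := by
  ext v
  simp [endCoord, ofCoord_toCoord hy]

theorem endCoord_id (hy : y ∈ (chartAt E x₀).source) :
    endCoord x₀ y (ContinuousLinearMap.id ℝ (TangentSpace 𝓘(ℝ, E) y)) = 1 := by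
  ext v
  simp [endCoord, toCoord_ofCoord hy]

theorem endCoord_apply_toCoord (hy : y ∈ (chartAt E x₀).source) (A : EndFiber E M y)
    (v : TangentSpace 𝓘(ℝ, E) y) : endCoord x₀ y A (toCoord x₀ y v) = toCoord x₀ y (A v) := by
  simp [endCoord, ofCoord_toCoord hy]

theorem endCoord_add (A B : EndFiber E M y) :
    endCoord x₀ y (A + B) = endCoord x₀ y A + endCoord x₀ y B := by
  ext v
  simp [endCoord]

theorem endCoord_smul (r : ℝ) (A : EndFiber E M y) :
    endCoord x₀ y (r • A) = r • endCoord x₀ y A := by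
  ext v
  simp [endCoord]

theorem endCoord_injective (hy : y ∈ (chartAt E x₀).source) :
    Function.Injective (endCoord x₀ y : EndFiber E M y → E →L[ℝ] E) := by
  intro A B h
  ext v
  have := DFunLike.congr_fun h (toCoord x₀ y v)
  rw [endCoord_apply_toCoord hy, endCoord_apply_toCoord hy] at this
  rw [← ofCoord_toCoord hy (A v), this, ofCoord_toCoord hy]

theorem contMDiffAt_end_section_iff {n : ℕ∞ω} (hn : n ≤ ∞) (hy : y ∈ (chartAt E x₀).source)
    (σ : ∀ z : M, EndFiber E M z) :
    ContMDiffAt 𝓘(ℝ, E) (endModel E) n (fun z ↦ (⟨z, σ z⟩ : EndTotal E M)) y ↔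
      ContMDiffAt 𝓘(ℝ, E) 𝓘(ℝ, E →L[ℝ] E) n (fun z ↦ endCoord x₀ z (σ z)) y := by
  have : ContMDiffVectorBundle n (E →L[ℝ] E) (EndFiber E M) 𝓘(ℝ, E) := .of_le hn
  have h := (trivializationAt (E →L[ℝ] E) (EndFiber E M) x₀).contMDiffAt_section_iff
    (IB := 𝓘(ℝ, E)) (n := n) (s := σ) (x₀ := y) ⟨hy, hy⟩
  simpa only [trivializationAt_end_apply] using h

theorem mdifferentiableAt_end_section_iff (hy : y ∈ (chartAt E x₀).source)
    (σ : ∀ z : M, EndFiber E M z) :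
    MDifferentiableAt 𝓘(ℝ, E) (endModel E) (fun z ↦ (⟨z, σ z⟩ : EndTotal E M)) y ↔
      MDifferentiableAt 𝓘(ℝ, E) 𝓘(ℝ, E →L[ℝ] E) (fun z ↦ endCoord x₀ z (σ z)) y := by
  have h := (trivializationAt (E →L[ℝ] E) (EndFiber E M) x₀).mdifferentiableAt_section_iff
    𝓘(ℝ, E) σ (b₀ := y) ⟨hy, hy⟩
  simpa only [trivializationAt_end_apply] using h

theorem contMDiffAt_ofCoord {n : ℕ∞ω} (hn : n ≤ ∞) (hy : y ∈ (chartAt E x₀).source)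
    {f : M → E} (hf : ContMDiffAt 𝓘(ℝ, E) 𝓘(ℝ, E) n f y) :
    ContMDiffAt 𝓘(ℝ, E) 𝓘(ℝ, E).tangent n
      (fun z ↦ (⟨z, ofCoord x₀ z (f z)⟩ : TangentBundle 𝓘(ℝ, E) M)) y := by
  have : ContMDiffVectorBundle n E (TangentSpace 𝓘(ℝ, E) : M → Type _) 𝓘(ℝ, E) := .of_le hn
  refine ((trivializationAt E (TangentSpace 𝓘(ℝ, E) : M → Type _) x₀).contMDiffAt_section_iff
    (IB := 𝓘(ℝ, E)) (n := n) (s := fun z ↦ ofCoord x₀ z (f z)) (x₀ := y) hy).mpr ?_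
  refine hf.congr_of_eventuallyEq ?_
  filter_upwards [(chartAt E x₀).open_source.mem_nhds hy] with z hz
  exact trivializationAt_ofCoord hz (f z)

theorem mdifferentiableAt_ofCoord (hy : y ∈ (chartAt E x₀).source)
    {f : M → E} (hf : MDifferentiableAt 𝓘(ℝ, E) 𝓘(ℝ, E) f y) :
    MDifferentiableAt 𝓘(ℝ, E) 𝓘(ℝ, E).tangent
      (fun z ↦ (⟨z, ofCoord x₀ z (f z)⟩ : TangentBundle 𝓘(ℝ, E) M)) y := by
  refine ((trivializationAt E (TangentSpace 𝓘(ℝ, E) : M → Type _) x₀).mdifferentiableAt_section_iff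
    𝓘(ℝ, E) (fun z ↦ ofCoord x₀ z (f z)) (b₀ := y) hy).mpr ?_
  refine hf.congr_of_eventuallyEq ?_
  filter_upwards [(chartAt E x₀).open_source.mem_nhds hy] with z hz
  exact trivializationAt_ofCoord hz (f z)

end Coordinates

/-! ### Christoffel symbols -/

section Connection

variable {E : Type*} [NormedAddCommGroup E] [NormedSpace ℝ E]
  {M : Type*} [TopologicalSpace M] [ChartedSpace E M] [IsManifold 𝓘(ℝ, E) ∞ M]
  (cov : CovariantDerivative 𝓘(ℝ, E) E (TangentSpace 𝓘(ℝ, E) : M → Type _))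

theorem cov_sum_smul {ι : Type*} (s : Finset ι) (g : ι → M → ℝ)
    (σ : ι → ∀ z : M, TangentSpace 𝓘(ℝ, E) z) {y : M}
    (hg : ∀ i, MDifferentiableAt 𝓘(ℝ, E) 𝓘(ℝ, ℝ) (g i) y)
    (hσ : ∀ i, MDifferentiableAt 𝓘(ℝ, E) 𝓘(ℝ, E).tangent
      (fun z ↦ (⟨z, σ i z⟩ : TangentBundle 𝓘(ℝ, E) M)) y) (X : TangentSpace 𝓘(ℝ, E) y) :
    cov (fun z ↦ ∑ i ∈ s, g i z • σ i z) y X =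
      ∑ i ∈ s, (g i y • cov (σ i) y X + mvfderiv 𝓘(ℝ, E) (g i) y X • σ i y) := by
  classical
  induction s using Finset.induction_on with
  | empty =>
    simp only [Finset.sum_empty]
    have := cov.zero
    exact congrArg (fun (τ : ∀ z : M, TangentSpace 𝓘(ℝ, E) z →L[ℝ] TangentSpace 𝓘(ℝ, E) z) ↦
      τ y X) this
  | insert a s ha ih =>
    have h1 : (fun z ↦ ∑ i ∈ insert a s, g i z • σ i z) =
        (g a • σ a) + (fun z ↦ ∑ i ∈ s, g i z • σ i z) := by
      ext1 z
      simp [Finset.sum_insert ha]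
    have h2 : MDifferentiableAt 𝓘(ℝ, E) 𝓘(ℝ, E).tangent
        (fun z ↦ (⟨z, (g a • σ a) z⟩ : TangentBundle 𝓘(ℝ, E) M)) y := (hg a).smul_section (hσ a)
    have h3 : MDifferentiableAt 𝓘(ℝ, E) 𝓘(ℝ, E).tangent
        (fun z ↦ (⟨z, ∑ i ∈ s, g i z • σ i z⟩ : TangentBundle 𝓘(ℝ, E) M)) y :=
      .sum_section fun i _ ↦ (hg i).smul_section (hσ i)
    rw [h1, cov.isCovariantDerivativeOnUniv.add h2 h3,
      cov.isCovariantDerivativeOnUniv.leibniz (hσ a) (hg a), Finset.sum_insert ha, ← ih]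
    simp

variable [FiniteDimensional ℝ E]

/-- The Christoffel symbols `Γ ξ v` of a connection at `y`, in the chart at `x₀`. They are defined
from the covariant derivatives of the coordinate fields that belong to a basis of `E`. -/
noncomputable def christoffel (x₀ y : M) : E →L[ℝ] E →L[ℝ] E :=
  ∑ i, (ContinuousLinearMap.smulRightL ℝ E E
      (LinearMap.toContinuousLinearMap ((Module.finBasis ℝ E).coord i))) ∘L
    endCoord x₀ y (cov (fun z ↦ ofCoord x₀ z (Module.finBasis ℝ E i)) y)

theorem toCoord_cov {x₀ y : M} (hy : y ∈ (chartAt E x₀).source) {f : M → E}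
    (hf : MDifferentiableAt 𝓘(ℝ, E) 𝓘(ℝ, E) f y) (X : TangentSpace 𝓘(ℝ, E) y) :
    toCoord x₀ y (cov (fun z ↦ ofCoord x₀ z (f z)) y X) =
      mvfderiv 𝓘(ℝ, E) f y X + christoffel cov x₀ y (toCoord x₀ y X) (f y) := by
  set b := Module.finBasis ℝ E with hb
  let c : Fin (Module.finrank ℝ E) → E →L[ℝ] ℝ := fun i ↦
    LinearMap.toContinuousLinearMap (b.coord i)
  have hc : ∀ v : E, ∑ i, c i v • b i = v := fun v ↦ b.sum_repr v
  have hg : ∀ i, HasMFDerivAt 𝓘(ℝ, E) 𝓘(ℝ, ℝ) (fun z ↦ c i (f z)) y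
      ((c i) ∘L (mfderiv 𝓘(ℝ, E) 𝓘(ℝ, E) f y)) := fun i ↦
    (c i).hasMFDerivAt.comp y hf.hasMFDerivAt
  have h1 : (fun z ↦ ofCoord x₀ z (f z)) =
      fun z ↦ ∑ i, (fun z ↦ c i (f z)) z • (fun z ↦ ofCoord x₀ z (b i)) z := by
    ext1 z
    rw [← hc (f z), map_sum]
    simp only [map_smul]
  rw [h1, cov_sum_smul cov Finset.univ (fun i z ↦ c i (f z)) (fun i z ↦ ofCoord x₀ z (b i))
    (fun i ↦ (hg i).mdifferentiableAt)
    (fun i ↦ mdifferentiableAt_ofCoord hy mdifferentiableAt_const) X]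
  rw [map_sum]
  simp only [map_add, map_smul, toCoord_ofCoord hy, Finset.sum_add_distrib]
  rw [add_comm]
  congr 1
  · rw [← hc (mvfderiv 𝓘(ℝ, E) f y X)]
    refine Finset.sum_congr rfl fun i _ ↦ ?_
    congr 1
    exact DFunLike.congr_fun (hg i).mfderiv X
  · simp only [christoffel, sum_apply]
    refine Finset.sum_congr rfl fun i _ ↦ ?_
    simp [c, endCoord_apply_toCoord hy, ← hb]

theorem endCoord_endCov {x₀ y : M} (hy : y ∈ (chartAt E x₀).source) {σ : ∀ z : M, EndFiber E M z}
    (hσ : MDifferentiableAt 𝓘(ℝ, E) (endModel E) (fun z ↦ (⟨z, σ z⟩ : EndTotal E M)) y)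
    (X : TangentSpace 𝓘(ℝ, E) y) :
    endCoord x₀ y (endCov cov σ y X) =
      mvfderiv 𝓘(ℝ, E) (fun z ↦ endCoord x₀ z (σ z)) y X +
        (christoffel cov x₀ y (toCoord x₀ y X) * endCoord x₀ y (σ y) -
          endCoord x₀ y (σ y) * christoffel cov x₀ y (toCoord x₀ y X)) := by
  ext η
  have hd := (mdifferentiableAt_end_section_iff hy σ).mp hσ
  have hη : MDifferentiableAt 𝓘(ℝ, E) 𝓘(ℝ, E).tangent
      (fun z ↦ (⟨z, ofCoord x₀ z η⟩ : TangentBundle 𝓘(ℝ, E) M)) y :=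
    mdifferentiableAt_ofCoord hy mdifferentiableAt_const
  have h0 : endCov cov σ y X (ofCoord x₀ y η) =
      cov (fun z ↦ σ z (ofCoord x₀ z η)) y X - σ y (cov (fun z ↦ ofCoord x₀ z η) y X) := by
    rw [endCov, dif_pos hσ]
    have := TensorialAt.mkHom_apply (tensorialAt_endCov cov σ y X hσ)
      (σ := fun z ↦ ofCoord x₀ z η) hη
    exact this
  have hf : HasMFDerivAt 𝓘(ℝ, E) 𝓘(ℝ, E) (fun z ↦ endCoord x₀ z (σ z) η) y
      ((ContinuousLinearMap.apply ℝ E η) ∘L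
        (mfderiv 𝓘(ℝ, E) 𝓘(ℝ, E →L[ℝ] E) (fun z ↦ endCoord x₀ z (σ z)) y)) :=
    (ContinuousLinearMap.apply ℝ E η).hasMFDerivAt.comp y hd.hasMFDerivAt
  have h1 : cov (fun z ↦ σ z (ofCoord x₀ z η)) y =
      cov (fun z ↦ ofCoord x₀ z (endCoord x₀ z (σ z) η)) y := by
    refine cov.isCovariantDerivativeOnUniv.congr_of_eventuallyEq (hσ.clm_bundle_apply hη)
      (mdifferentiableAt_ofCoord hy hf.mdifferentiableAt) Filter.univ_mem ?_
    filter_upwards [(chartAt E x₀).open_source.mem_nhds hy] with z hz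
    simp [endCoord, ofCoord_toCoord hz]
  have h2 := toCoord_cov cov hy hf.mdifferentiableAt X
  have h3 := toCoord_cov cov hy (f := fun _ ↦ η) mdifferentiableAt_const X
  have h4 : mvfderiv 𝓘(ℝ, E) (fun _ : M ↦ η) y X = 0 := by
    simp [mvfderiv]
  have h5 : mvfderiv 𝓘(ℝ, E) (fun z ↦ endCoord x₀ z (σ z) η) y X =
      mvfderiv 𝓘(ℝ, E) (fun z ↦ endCoord x₀ z (σ z)) y X η :=
    DFunLike.congr_fun hf.mfderiv X
  rw [h4] at h3
  rw [h5] at h2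
  change toCoord x₀ y (endCov cov σ y X (ofCoord x₀ y η)) = _
  rw [h0, map_sub, h1, h2, ← endCoord_apply_toCoord hy, h3]
  simp only [add_apply, sub_apply, mul_apply_eq_comp, zero_add]
  exact add_sub_assoc _ _ _

end Connection

/-! ### Horizontal and vertical vectors in coordinates -/

section EndChart

variable {E : Type*} [NormedAddCommGroup E] [NormedSpace ℝ E]
  {M : Type*} [TopologicalSpace M] [ChartedSpace E M] [IsManifold 𝓘(ℝ, E) ∞ M]

theorem extChartAt_end' (A₀ : EndTotal E M) :
    (extChartAt (endModel E) A₀ : EndTotal E M → E × (E →L[ℝ] E)) = endChart A₀.1 :=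
  funext (extChartAt_end A₀)

theorem contMDiffAt_endChart {x₀ : M} {A : EndTotal E M} (hA : A.1 ∈ (chartAt E x₀).source) :
    ContMDiffAt (endModel E) 𝓘(ℝ, E × (E →L[ℝ] E)) ∞ (endChart x₀) A := by
  have h : A ∈ (extChartAt (endModel E) (⟨x₀, 0⟩ : EndTotal E M)).source := by
    rw [extChartAt_end_source]; exact hA
  rw [extChartAt_source] at h
  have := contMDiffAt_extChartAt' (I := endModel E) (n := ∞) h
  rwa [extChartAt_end'] at this

/-- The coordinates of a tangent vector of `End(TM)` at `A`, in the chart induced by the chart at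
`x₀`. -/
noncomputable def endChartDeriv (x₀ : M) (A : EndTotal E M) :
    EndTangent E M A →L[ℝ] E × (E →L[ℝ] E) :=
  mvfderiv (endModel E) (endChart x₀) A

theorem isInvertible_endChartDeriv {x₀ : M} {A : EndTotal E M}
    (hA : A.1 ∈ (chartAt E x₀).source) : (endChartDeriv x₀ A).IsInvertible := by
  have h : A ∈ (extChartAt (endModel E) (⟨x₀, 0⟩ : EndTotal E M)).source := by
    rw [extChartAt_end_source]; exact hA
  have := isInvertible_mfderiv_extChartAt h
  rw [extChartAt_end'] at this
  exact this

theorem endChartDeriv_injective {x₀ : M} {A : EndTotal E M}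
    (hA : A.1 ∈ (chartAt E x₀).source) : Function.Injective (endChartDeriv x₀ A) :=
  (isInvertible_endChartDeriv hA).injective

theorem endChartDeriv_fst {x₀ : M} {A : EndTotal E M} (hA : A.1 ∈ (chartAt E x₀).source)
    (W : EndTangent E M A) : (endChartDeriv x₀ A W).1 = toCoord x₀ A.1 (projDeriv A W) := by
  have h1 : MDifferentiableAt (endModel E) 𝓘(ℝ, E × (E →L[ℝ] E)) (endChart x₀) A :=
    (contMDiffAt_endChart hA).mdifferentiableAt (by simp)
  have h2 : mfderiv (endModel E) 𝓘(ℝ, E) (fun B ↦ (endChart x₀ B).1) A =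
      (ContinuousLinearMap.fst ℝ E (E →L[ℝ] E)) ∘L
        (mfderiv (endModel E) 𝓘(ℝ, E × (E →L[ℝ] E)) (endChart x₀) A) :=
    ((ContinuousLinearMap.fst ℝ E (E →L[ℝ] E)).hasMFDerivAt.comp A h1.hasMFDerivAt).mfderiv
  have h3 : mfderiv (endModel E) 𝓘(ℝ, E)
      ((extChartAt 𝓘(ℝ, E) x₀) ∘ (fun B : EndTotal E M ↦ B.1)) A = _ :=
    mfderiv_comp A (mdifferentiableAt_extChartAt hA) (mdifferentiableAt_proj _)
  rw [toCoord_eq_mfderiv hA]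
  exact (DFunLike.congr_fun h2 W).symm.trans (DFunLike.congr_fun h3 W)

theorem endChartDeriv_verticalLift {x₀ : M} {A : EndTotal E M}
    (hA : A.1 ∈ (chartAt E x₀).source) (B : EndFiber E M A.1) :
    endChartDeriv x₀ A (verticalLift A B) = (0, endCoord x₀ A.1 B) := by
  have h1 : MDifferentiableAt (endModel E) 𝓘(ℝ, E × (E →L[ℝ] E)) (endChart x₀) A :=
    (contMDiffAt_endChart hA).mdifferentiableAt (by simp)
  refine (mfderiv_verticalLift (J := 𝓘(ℝ, E × (E →L[ℝ] E))) (endChart x₀) A h1 B).trans ?_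
  have : (fun t : ℝ ↦ endChart x₀ (⟨A.1, A.2 + t • B⟩ : EndTotal E M)) =
      fun t ↦ endChart x₀ A + t • (0, endCoord x₀ A.1 B) := by
    ext1 t
    simp [endChart, endCoord_add, endCoord_smul]
  rw [this, mfderiv_eq_fderiv]
  have hd : HasDerivAt (fun t : ℝ ↦ endChart x₀ A + t • ((0 : E), endCoord x₀ A.1 B))
      ((1 : ℝ) • ((0 : E), endCoord x₀ A.1 B)) 0 :=
    ((hasDerivAt_id (0 : ℝ)).smul_const _).const_add _
  rw [one_smul] at hd
  exact hd.deriv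

theorem endChartDeriv_section {x₀ : M} {A : EndTotal E M} (hA : A.1 ∈ (chartAt E x₀).source)
    {σ : ∀ z : M, EndFiber E M z} (hσA : σ A.1 = A.2)
    (hσ : MDifferentiableAt 𝓘(ℝ, E) (endModel E) (fun z ↦ (⟨z, σ z⟩ : EndTotal E M)) A.1)
    (X : TangentSpace 𝓘(ℝ, E) A.1) :
    endChartDeriv x₀ A (mfderiv 𝓘(ℝ, E) (endModel E) (fun z ↦ (⟨z, σ z⟩ : EndTotal E M)) A.1 X) =
      (toCoord x₀ A.1 X, mvfderiv 𝓘(ℝ, E) (fun z ↦ endCoord x₀ z (σ z)) A.1 X) := by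
  have c0 : (⟨A.1, σ A.1⟩ : EndTotal E M) = A := by rw [hσA]
  have h1 : MDifferentiableAt (endModel E) 𝓘(ℝ, E × (E →L[ℝ] E)) (endChart x₀) A :=
    (contMDiffAt_endChart hA).mdifferentiableAt (by simp)
  have h2 : mfderiv 𝓘(ℝ, E) 𝓘(ℝ, E × (E →L[ℝ] E))
      (endChart x₀ ∘ (fun z ↦ (⟨z, σ z⟩ : EndTotal E M))) A.1 = _ :=
    mfderiv_comp A.1 (by rw [c0]; exact h1) hσ
  have h3 : ∀ p : EndTotal E M, p = A →
      (mfderiv (endModel E) 𝓘(ℝ, E × (E →L[ℝ] E)) (endChart x₀) p :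
        (E × (E →L[ℝ] E)) →L[ℝ] (E × (E →L[ℝ] E))) =
      mfderiv (endModel E) 𝓘(ℝ, E × (E →L[ℝ] E)) (endChart x₀) A := by
    rintro _ rfl; rfl
  have h4 : MDifferentiableAt 𝓘(ℝ, E) 𝓘(ℝ, E × (E →L[ℝ] E))
      (fun z ↦ (extChartAt 𝓘(ℝ, E) x₀ z, endCoord x₀ z (σ z))) A.1 :=
    (mdifferentiableAt_extChartAt hA).prodMk_space
      ((mdifferentiableAt_end_section_iff hA σ).mp hσ)
  have h5 : mfderiv 𝓘(ℝ, E) 𝓘(ℝ, E) (extChartAt 𝓘(ℝ, E) x₀) A.1 = _ :=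
    ((ContinuousLinearMap.fst ℝ E (E →L[ℝ] E)).hasMFDerivAt.comp A.1 h4.hasMFDerivAt).mfderiv
  have h6 : mfderiv 𝓘(ℝ, E) 𝓘(ℝ, E →L[ℝ] E) (fun z ↦ endCoord x₀ z (σ z)) A.1 = _ :=
    ((ContinuousLinearMap.snd ℝ E (E →L[ℝ] E)).hasMFDerivAt.comp A.1 h4.hasMFDerivAt).mfderiv
  rw [toCoord_eq_mfderiv hA]
  refine Eq.trans ?_ (Prod.ext (DFunLike.congr_fun h5 X).symm (DFunLike.congr_fun h6 X).symm)
  refine Eq.trans ?_ (DFunLike.congr_fun h2 X).symm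
  exact (DFunLike.congr_fun (h3 (⟨A.1, σ A.1⟩ : EndTotal E M) c0) _).symm

variable [FiniteDimensional ℝ E]
  (cov : CovariantDerivative 𝓘(ℝ, E) E (TangentSpace 𝓘(ℝ, E) : M → Type _))

theorem endChartDeriv_horizontalLift {x₀ : M} {A : EndTotal E M}
    (hA : A.1 ∈ (chartAt E x₀).source) (X : TangentSpace 𝓘(ℝ, E) A.1) :
    letI g := christoffel cov x₀ A.1 (toCoord x₀ A.1 X)
    letI a := endCoord x₀ A.1 A.2
    endChartDeriv x₀ A (horizontalLift cov A X) = (toCoord x₀ A.1 X, -(g * a - a * g)) := by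
  set σ : ∀ y : M, EndFiber E M y := FiberBundle.extend (E →L[ℝ] E) A.2 with hσ
  have hd : MDifferentiableAt 𝓘(ℝ, E) (endModel E) (fun y ↦ (⟨y, σ y⟩ : EndTotal E M)) A.1 :=
    FiberBundle.mdifferentiableAt_extend 𝓘(ℝ, E) (E →L[ℝ] E) A.2
  have c0 : σ A.1 = A.2 := by simp [hσ]
  refine (ContinuousLinearMap.map_sub _ _ _).trans ?_
  rw [endChartDeriv_verticalLift hA, endCoord_endCov cov hA hd]
  refine (congrArg (· - _) (endChartDeriv_section hA c0 hd X)).trans ?_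
  rw [c0]
  ext1
  · simp
  · simp

/-- The defining property of `verticalPart`. -/
theorem verticalLift_verticalPart (A : EndTotal E M) (W : EndTangent E M A) :
    verticalLift A (verticalPart cov A W) = W - horizontalLift cov A (projDeriv A W) :=
  (existsUnique_verticalLift A (W - horizontalLift cov A (projDeriv A W)) (by
    refine (ContinuousLinearMap.map_sub _ _ _).trans ?_
    rw [projDeriv_horizontalLift, sub_self])).choose_spec.1

theorem endChartDeriv_twistorI {x₀ : M} {A : EndTotal E M}
    (hA : A.1 ∈ (chartAt E x₀).source) (W : EndTangent E M A) :
    endChartDeriv x₀ A (twistorI cov A W) =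
      localTwistorI (christoffel cov x₀ A.1) (endChart x₀ A).2 (endChartDeriv x₀ A W) := by
  have h1 := endChartDeriv_verticalLift hA (verticalPart cov A W)
  rw [verticalLift_verticalPart] at h1
  have h2 := (ContinuousLinearMap.map_sub (endChartDeriv x₀ A) W
    (horizontalLift cov A (projDeriv A W))).symm.trans h1
  rw [endChartDeriv_horizontalLift cov hA, ← endChartDeriv_fst hA] at h2
  have h3 : endCoord x₀ A.1 (verticalPart cov A W) = (endChartDeriv x₀ A W).2 +
      (christoffel cov x₀ A.1 (endChartDeriv x₀ A W).1 * endCoord x₀ A.1 A.2 -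
        endCoord x₀ A.1 A.2 * christoffel cov x₀ A.1 (endChartDeriv x₀ A W).1) := by
    have := congrArg Prod.snd h2
    refine this.symm.trans ?_
    simp only [Prod.snd_sub]
    abel
  refine (ContinuousLinearMap.map_add _ _ _).trans ?_
  rw [endChartDeriv_horizontalLift cov hA, endChartDeriv_verticalLift hA, endCoord_comp hA, h3,
    ← endCoord_apply_toCoord hA, ← endChartDeriv_fst hA]
  ext1
  · simp [localTwistorI, endChart]
  · simp only [localTwistorI, endChart, Prod.snd_add]
    abel

end EndChart

/-! ### Local sections -/

section Localization

variable {E : Type*} [NormedAddCommGroup E] [NormedSpace ℝ E]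
  {M : Type*} [TopologicalSpace M] [ChartedSpace E M]

theorem extChartAt_symm_mem {x₀ : M} {x : E} (hx : x ∈ (extChartAt 𝓘(ℝ, E) x₀).target) :
    (extChartAt 𝓘(ℝ, E) x₀).symm x ∈ (chartAt E x₀).source := by
  have := (extChartAt 𝓘(ℝ, E) x₀).map_target hx
  rwa [extChartAt_source] at this

variable [IsManifold 𝓘(ℝ, E) ∞ M] {F : Type*} [NormedAddCommGroup F] [NormedSpace ℝ F]

theorem contDiffAt_comp_extChartAt_symm {x₀ : M} {x : E}
    (hx : x ∈ (extChartAt 𝓘(ℝ, E) x₀).target) {f : M → F}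
    (hf : ContMDiffAt 𝓘(ℝ, E) 𝓘(ℝ, F) ∞ f ((extChartAt 𝓘(ℝ, E) x₀).symm x)) :
    ContDiffAt ℝ ∞ (f ∘ (extChartAt 𝓘(ℝ, E) x₀).symm) x := by
  rw [← contMDiffAt_iff_contDiffAt]
  exact ContMDiffAt.comp x hf (contMDiffOn_extChartAt_symm x₀ |>.contMDiffAt
    ((isOpen_extChartAt_target x₀).mem_nhds hx))

theorem mvfderiv_eq_fderiv_comp_symm {x₀ y : M} (hy : y ∈ (chartAt E x₀).source) {f : M → F}
    (hf : MDifferentiableAt 𝓘(ℝ, E) 𝓘(ℝ, F) f y) (X : TangentSpace 𝓘(ℝ, E) y) :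
    mvfderiv 𝓘(ℝ, E) f y X =
      fderiv ℝ (f ∘ (extChartAt 𝓘(ℝ, E) x₀).symm) (extChartAt 𝓘(ℝ, E) x₀ y)
        (toCoord x₀ y X) := by
  set φ := extChartAt 𝓘(ℝ, E) x₀ with hφ
  have hy' : y ∈ φ.source := by rwa [hφ, extChartAt_source]
  have h1 : f =ᶠ[𝓝 y] (f ∘ φ.symm) ∘ φ := by
    filter_upwards [(isOpen_extChartAt_source x₀).mem_nhds hy'] with z hz
    simp [φ.left_inv hz]
  have hs : MDifferentiableAt 𝓘(ℝ, E) 𝓘(ℝ, E) φ.symm (φ y) :=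
    ((contMDiffOn_extChartAt_symm (n := ∞) x₀).contMDiffAt
      ((isOpen_extChartAt_target x₀).mem_nhds (φ.map_source hy'))).mdifferentiableAt (by simp)
  have h2 : MDifferentiableAt 𝓘(ℝ, E) 𝓘(ℝ, F) (f ∘ φ.symm) (φ y) :=
    MDifferentiableAt.comp (φ y) (by rw [φ.left_inv hy']; exact hf) hs
  have h3 : mfderiv 𝓘(ℝ, E) 𝓘(ℝ, F) ((f ∘ φ.symm) ∘ φ) y = _ :=
    mfderiv_comp y h2 (mdifferentiableAt_extChartAt hy)
  rw [toCoord_eq_mfderiv hy, ← mfderiv_eq_fderiv]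
  have h4 := h1.mfderiv_eq (I := 𝓘(ℝ, E)) (I' := 𝓘(ℝ, F))
  exact (DFunLike.congr_fun h4 X).trans (DFunLike.congr_fun h3 X)

variable [FiniteDimensional ℝ E]

theorem endCov_congr (cov : CovariantDerivative 𝓘(ℝ, E) E (TangentSpace 𝓘(ℝ, E) : M → Type _))
    {σ τ : ∀ z : M, EndFiber E M z} {y : M}
    (hσ : MDifferentiableAt 𝓘(ℝ, E) (endModel E) (fun z ↦ (⟨z, σ z⟩ : EndTotal E M)) y)
    (hτ : MDifferentiableAt 𝓘(ℝ, E) (endModel E) (fun z ↦ (⟨z, τ z⟩ : EndTotal E M)) y)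
    (h : ∀ᶠ z in 𝓝 y, σ z = τ z) (X : TangentSpace 𝓘(ℝ, E) y) :
    endCov cov σ y X = endCov cov τ y X := by
  have hy : y ∈ (chartAt E y).source := mem_chart_source E y
  apply endCoord_injective hy
  rw [endCoord_endCov cov hy hσ, endCoord_endCov cov hy hτ, h.self_of_nhds]
  have : (fun z ↦ endCoord y z (σ z)) =ᶠ[𝓝 y] fun z ↦ endCoord y z (τ z) := by
    filter_upwards [h] with z hz
    rw [hz]
  rw [mvfderiv, mvfderiv, this.mfderiv_eq]
  rfl

variable [T2Space M]

theorem exists_bump {y : M} {U : Set M} (hU : U ∈ 𝓝 y) :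
    ∃ ψ : M → ℝ, ContMDiff 𝓘(ℝ, E) 𝓘(ℝ, ℝ) ∞ ψ ∧ tsupport ψ ⊆ U ∧ ψ =ᶠ[𝓝 y] 1 := by
  obtain ⟨f, -, hf⟩ := (SmoothBumpFunction.nhds_basis_tsupport (I := 𝓘(ℝ, E)) y).mem_iff.mp hU
  exact ⟨f, f.contMDiff, hf, f.eventuallyEq_one⟩

/-- A quaternionic connection preserves local sections of `Q`: they agree near any given point with
global sections. -/
theorem IsQuaternionicConnection.endCov_mem {Q : AlmostQuaternionicStructure E M}
    {cov : CovariantDerivative 𝓘(ℝ, E) E (TangentSpace 𝓘(ℝ, E) : M → Type _)}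
    (hcov : IsQuaternionicConnection Q cov) {σ : ∀ z : M, EndFiber E M z} {y : M} {U : Set M}
    (hU : IsOpen U) (hy : y ∈ U)
    (hσ : ContMDiffOn 𝓘(ℝ, E) (endModel E) ∞ (fun z ↦ (⟨z, σ z⟩ : EndTotal E M)) U)
    (hσQ : ∀ z ∈ U, σ z ∈ Q.fiber z) (X : TangentSpace 𝓘(ℝ, E) y) :
    endCov cov σ y X ∈ Q.fiber y := by
  obtain ⟨ψ, hψ, hψU, hψ1⟩ := exists_bump (E := E) (hU.mem_nhds hy)
  have h1 : ContMDiff 𝓘(ℝ, E) (endModel E) ∞ (fun z ↦ (⟨z, (ψ • σ) z⟩ : EndTotal E M)) :=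
    ContMDiffOn.smul_section_of_tsupport hψ.contMDiffOn hU hψU hσ
  have h2 := hcov.preserves (ψ • σ) h1 (fun z ↦ by
    by_cases hz : z ∈ U
    · exact Submodule.smul_mem _ _ (hσQ z hz)
    · have : ψ z = 0 := image_eq_zero_of_notMem_tsupport fun h ↦ hz (hψU h)
      simp [this]) y X
  rwa [endCov_congr cov (τ := σ) ((h1 y).mdifferentiableAt (by simp))
    ((hσ.contMDiffAt (hU.mem_nhds hy)).mdifferentiableAt (by simp))] at h2
  filter_upwards [hψ1] with z hz
  simp [hz]

theorem contMDiffAt_christoffel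
    {cov : CovariantDerivative 𝓘(ℝ, E) E (TangentSpace 𝓘(ℝ, E) : M → Type _)}
    (hcov : cov.ContMDiffCovariantDerivative ∞) {x₀ y : M} (hy : y ∈ (chartAt E x₀).source) :
    ContMDiffAt 𝓘(ℝ, E) 𝓘(ℝ, E →L[ℝ] E →L[ℝ] E) ∞ (christoffel cov x₀) y := by
  have key : ∀ v : E, ContMDiffAt 𝓘(ℝ, E) 𝓘(ℝ, E →L[ℝ] E) ∞
      (fun z ↦ endCoord x₀ z (cov (fun z ↦ ofCoord x₀ z v) z)) y := by
    intro v
    rw [← contMDiffAt_end_section_iff le_rfl hy]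
    set s : ∀ z : M, TangentSpace 𝓘(ℝ, E) z := fun z ↦ ofCoord x₀ z v with hs
    have hsU : ContMDiffOn 𝓘(ℝ, E) 𝓘(ℝ, E).tangent ∞
        (fun z ↦ (⟨z, s z⟩ : TangentBundle 𝓘(ℝ, E) M)) (chartAt E x₀).source := fun z hz ↦
      (contMDiffAt_ofCoord le_rfl hz contMDiffAt_const).contMDiffWithinAt
    obtain ⟨ψ, hψ, hψU, hψ1⟩ := exists_bump (E := E) ((chartAt E x₀).open_source.mem_nhds hy)
    have h1 : ContMDiff 𝓘(ℝ, E) 𝓘(ℝ, E).tangent ∞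
        (fun z ↦ (⟨z, (ψ • s) z⟩ : TangentBundle 𝓘(ℝ, E) M)) :=
      ContMDiffOn.smul_section_of_tsupport hψ.contMDiffOn (chartAt E x₀).open_source hψU hsU
    have h2 := (hcov.contMDiff.contMDiff (σ := ψ • s) h1.contMDiffOn).contMDiffAt
      (Filter.univ_mem (f := 𝓝 y))
    refine h2.congr_of_eventuallyEq ?_
    filter_upwards [hψ1.eventuallyEq_nhds, (chartAt E x₀).open_source.mem_nhds hy] with z hz hz'
    congr 1
    refine cov.isCovariantDerivativeOnUniv.congr_of_eventuallyEq
      (mdifferentiableAt_ofCoord hz' mdifferentiableAt_const)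
      ((h1 z).mdifferentiableAt (by simp)) Filter.univ_mem ?_
    filter_upwards [hz] with w hw
    simp [hw, hs]
  unfold christoffel
  refine ContMDiffAt.sum fun i _ ↦ ?_
  exact contMDiffAt_const.clm_comp (key _)

end Localization

/-! ### Quaternionic connections in a chart -/

section LocalForm

variable {E : Type*} [NormedAddCommGroup E] [NormedSpace ℝ E]
  {M : Type*} [TopologicalSpace M] [ChartedSpace E M] [IsManifold 𝓘(ℝ, E) ∞ M]

theorem endCoord_neg {x₀ y : M} (A : EndFiber E M y) :
    endCoord x₀ y (-A) = -endCoord x₀ y A := by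
  ext v
  simp [endCoord]

theorem endCoord_mem_span_iff {x₀ y : M} (hy : y ∈ (chartAt E x₀).source)
    (B J₁ J₂ J₃ : EndFiber E M y) :
    endCoord x₀ y B ∈ Submodule.span ℝ
      {endCoord x₀ y J₁, endCoord x₀ y J₂, endCoord x₀ y J₃} ↔
      B ∈ Submodule.span ℝ {J₁, J₂, J₃} := by
  simp only [Submodule.mem_span_triple, ← endCoord_smul, ← endCoord_add,
    (endCoord_injective hy).eq_iff]

/-- The endomorphism of the tangent space with a given coordinate expression. -/
noncomputable def endOfCoord (x₀ y : M) (B : E →L[ℝ] E) : EndFiber E M y :=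
  ofCoord x₀ y ∘L B ∘L toCoord x₀ y

theorem endCoord_endOfCoord {x₀ y : M} (hy : y ∈ (chartAt E x₀).source) (B : E →L[ℝ] E) :
    endCoord x₀ y (endOfCoord x₀ y B) = B := by
  ext v
  simp [endCoord, endOfCoord, toCoord_ofCoord hy]

variable [FiniteDimensional ℝ E] [T2Space M]

/-- Near `x₀`, a quaternionic connection is given in the chart at `x₀` by a local quaternionic
connection, and the twistor space by its local twistor space. -/
theorem IsQuaternionicConnection.exists_local {Q : AlmostQuaternionicStructure E M}
    {cov : CovariantDerivative 𝓘(ℝ, E) E (TangentSpace 𝓘(ℝ, E) : M → Type _)}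
    (hcov : IsQuaternionicConnection Q cov) (x₀ : M) :
    ∃ (D : Set E) (J₁ J₂ J₃ : E → E →L[ℝ] E),
      IsLocalQuaternionicConnection D
        (fun x ↦ christoffel cov x₀ ((extChartAt 𝓘(ℝ, E) x₀).symm x)) J₁ J₂ J₃ ∧
      extChartAt 𝓘(ℝ, E) x₀ x₀ ∈ D ∧ D ⊆ (extChartAt 𝓘(ℝ, E) x₀).target ∧
      ∀ A : EndTotal E M, A.1 ∈ (chartAt E x₀).source → extChartAt 𝓘(ℝ, E) x₀ A.1 ∈ D →
        (A ∈ Q.twistorSpace ↔ endChart x₀ A ∈ localTwistorSpace D J₁ J₂ J₃) := by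
  obtain ⟨U, hU, hxU, J₁, J₂, J₃, hJ, hspan⟩ := Q.exists_admissible x₀
  set φ := extChartAt 𝓘(ℝ, E) x₀ with hφ
  have hsrc : ∀ {y}, y ∈ (chartAt E x₀).source → y ∈ φ.source := fun {y} hy ↦ by
    rwa [hφ, extChartAt_source]
  let D : Set E := φ.target ∩ φ.symm ⁻¹' U
  have hD : IsOpen D :=
    (continuousOn_extChartAt_symm x₀).isOpen_inter_preimage (isOpen_extChartAt_target x₀) hU
  have hDs : ∀ {x}, x ∈ D → φ.symm x ∈ (chartAt E x₀).source := fun {x} hx ↦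
    extChartAt_symm_mem hx.1
  let K : (∀ y : M, EndFiber E M y) → E → E →L[ℝ] E := fun J x ↦
    endCoord x₀ (φ.symm x) (J (φ.symm x))
  have hK : ∀ J : ∀ y : M, EndFiber E M y,
      ContMDiffOn 𝓘(ℝ, E) (endModel E) ∞ (fun x ↦ (⟨x, J x⟩ : EndTotal E M)) U →
      ContDiffOn ℝ ∞ (K J) D := fun J hJ x hx ↦ by
    have h1 := (contMDiffAt_end_section_iff le_rfl (hDs hx) J).mp
      (hJ.contMDiffAt (hU.mem_nhds hx.2))
    exact (contDiffAt_comp_extChartAt_symm hx.1 h1).contDiffWithinAt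
  have hKφ : ∀ (J : ∀ y : M, EndFiber E M y) {z : M}, z ∈ φ.source →
      K J (φ z) = endCoord x₀ z (J z) := fun J z hz ↦
    congrArg (fun w ↦ endCoord x₀ w (J w)) (φ.left_inv hz)
  refine ⟨D, K J₁, K J₂, K J₃, ⟨hD, ?_, hK J₁ hJ.smooth₁, hK J₂ hJ.smooth₂, hK J₃ hJ.smooth₃,
    ?_, ?_⟩, ⟨mem_extChartAt_target x₀, ?_⟩, Set.inter_subset_left, ?_⟩
  · intro x hx
    exact (contDiffAt_comp_extChartAt_symm hx.1
      (contMDiffAt_christoffel hcov.smooth (hDs hx))).contDiffWithinAt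
  · intro x hx
    refine ⟨?_, ?_, ?_, ?_⟩
    · rw [← endCoord_comp (hDs hx), hJ.sq₁ _ hx.2, endCoord_neg, endCoord_id (hDs hx)]
    · rw [← endCoord_comp (hDs hx), hJ.sq₂ _ hx.2, endCoord_neg, endCoord_id (hDs hx)]
    · rw [← endCoord_comp (hDs hx), hJ.mul₁₂ _ hx.2]
    · rw [← endCoord_comp (hDs hx), hJ.mul₂₁ _ hx.2, endCoord_neg]
  · intro s x hx hs ξ
    obtain ⟨V, hVs, hV, hxV⟩ := eventually_nhds_iff.mp hs
    let σ : ∀ y : M, EndFiber E M y := fun y ↦ endOfCoord x₀ y (s (φ y))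
    have hy := hDs hx
    -- the section of `End(TM)` with coordinate expression `s` is a smooth section of `Q` on `V'`
    let V' : Set M := φ.source ∩ φ ⁻¹' (D ∩ V)
    have hV' : IsOpen V' := (continuousOn_extChartAt x₀).isOpen_inter_preimage
      (isOpen_extChartAt_source x₀) (hD.inter hV)
    have hyV : φ.symm x ∈ V' := ⟨hsrc hy, by
      change φ (φ.symm x) ∈ D ∩ V
      rw [φ.right_inv hx.1]; exact ⟨hx, hxV⟩⟩
    have hV's : ∀ {y : M}, y ∈ V' → y ∈ (chartAt E x₀).source := fun {y} h ↦ by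
      have := h.1
      rwa [hφ, extChartAt_source] at this
    have hev : ∀ y ∈ V', (fun z ↦ endCoord x₀ z (σ z)) =ᶠ[𝓝 y] s ∘ φ := fun y h ↦ by
      filter_upwards [hV'.mem_nhds h] with z hz
      exact endCoord_endOfCoord (hV's hz) _
    have hσ : ContMDiffOn 𝓘(ℝ, E) (endModel E) ∞ (fun z ↦ (⟨z, σ z⟩ : EndTotal E M)) V' := by
      intro y h
      refine ((contMDiffAt_end_section_iff le_rfl (hV's h) σ).mpr ?_).contMDiffWithinAt
      refine ContMDiffAt.congr_of_eventuallyEq ?_ (hev y h)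
      exact ContMDiffAt.comp (I' := 𝓘(ℝ, E)) y (hVs _ h.2.2).1.contMDiffAt
        (contMDiffAt_extChartAt' (hV's h))
    have hσQ : ∀ z ∈ V', σ z ∈ Q.fiber z := fun z hz ↦ by
      have h1 := (hVs _ hz.2.2).2
      have h2 : z ∈ U := by
        have := hz.2.1.2
        rwa [Set.mem_preimage, φ.left_inv hz.1] at this
      rw [hspan z h2, ← endCoord_mem_span_iff (hV's hz), endCoord_endOfCoord (hV's hz)]
      simpa only [hKφ _ hz.1] using h1
    have h1 := hcov.endCov_mem hV' hyV hσ hσQ (ofCoord x₀ (φ.symm x) ξ)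
    rw [hspan _ hx.2, ← endCoord_mem_span_iff hy,
      endCoord_endCov cov hy ((hσ.contMDiffAt (hV'.mem_nhds hyV)).mdifferentiableAt (by simp)),
      toCoord_ofCoord hy, endCoord_endOfCoord hy,
      mvfderiv_eq_fderiv_comp_symm hy ((mdifferentiableAt_end_section_iff hy σ).mp
        ((hσ.contMDiffAt (hV'.mem_nhds hyV)).mdifferentiableAt (by simp))), toCoord_ofCoord hy,
      ← hφ, φ.right_inv hx.1] at h1
    have h2 : (fun z ↦ endCoord x₀ z (σ z)) ∘ φ.symm =ᶠ[𝓝 x] s := by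
      filter_upwards [hD.mem_nhds hx] with z hz
      simp only [Function.comp_apply]
      rw [endCoord_endOfCoord (hDs hz), φ.right_inv hz.1]
    rw [h2.fderiv_eq] at h1
    exact h1
  · change φ.symm (φ x₀) ∈ U
    rwa [φ.left_inv (mem_extChartAt_source x₀)]
  · intro A hA hAD
    have hAU : A.1 ∈ U := by
      have := hAD.2
      rwa [Set.mem_preimage, φ.left_inv (hsrc hA)] at this
    have h1 : endCoord x₀ A.1 A.2 * endCoord x₀ A.1 A.2 = -1 ↔
        A.2 ∘L A.2 = -ContinuousLinearMap.id ℝ _ := by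
      rw [← endCoord_comp hA, ← endCoord_id hA, ← endCoord_neg, (endCoord_injective hA).eq_iff]
    have h2 := endCoord_mem_span_iff hA A.2 (J₁ A.1) (J₂ A.1) (J₃ A.1)
    simp only [AlmostQuaternionicStructure.twistorSpace, localTwistorSpace, Set.mem_ofPred_eq,
      endChart, hspan _ hAU, ← hφ, hKφ _ (hsrc hA), h1, h2, hAD, true_and]

end LocalForm

/-! ### Vector fields and Lie brackets in coordinates -/

section Brackets

/-- The Lie bracket in coordinates `f`: if `V`, `W` have the coordinate expressions `V'`, `W'`, then
`⁅V, W⁆` has the coordinate expression `⁅V', W'⁆`. -/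
theorem mvfderiv_mlieBracket {F H N : Type*} [NormedAddCommGroup F] [NormedSpace ℝ F]
    [CompleteSpace F] [TopologicalSpace H] {I : ModelWithCorners ℝ F H} [TopologicalSpace N]
    [ChartedSpace H N] [IsManifold I ∞ N] {f : N → F} {y : N}
    (hf : ContMDiffAt I 𝓘(ℝ, F) ∞ f y)
    (hinv : ∀ᶠ z in 𝓝 y, (mvfderiv I f z).IsInvertible)
    {V W : ∀ z : N, TangentSpace I z} {V' W' : F → F}
    (hV' : DifferentiableAt ℝ V' (f y)) (hW' : DifferentiableAt ℝ W' (f y))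
    (hV : ∀ᶠ z in 𝓝 y, mvfderiv I f z (V z) = V' (f z))
    (hW : ∀ᶠ z in 𝓝 y, mvfderiv I f z (W z) = W' (f z)) :
    mvfderiv I f y (VectorField.mlieBracket I V W y) = VectorField.lieBracket ℝ V' W' (f y) := by
  have key : ∀ {V : ∀ z : N, TangentSpace I z} {V' : F → F},
      (∀ᶠ z in 𝓝 y, mvfderiv I f z (V z) = V' (f z)) →
      V =ᶠ[𝓝 y] VectorField.mpullback I 𝓘(ℝ, F) f V' := fun {V V'} h ↦ by
    filter_upwards [h, hinv] with z hz hz'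
    have : (mvfderiv I f z).inverse (V' (f z)) = V z := by
      rw [← hz]
      exact hz'.inverse_apply_self (V z)
    exact this.symm
  have hd : ∀ {V' : F → F}, DifferentiableAt ℝ V' (f y) → MDifferentiableAt 𝓘(ℝ, F)
      𝓘(ℝ, F).tangent (fun x ↦ (⟨x, V' x⟩ : TangentBundle 𝓘(ℝ, F) F)) (f y) := fun {V'} h ↦ by
    rw [mdifferentiableAt_totalSpace]
    exact ⟨mdifferentiableAt_id, by simpa using h.mdifferentiableAt⟩
  have h1 : VectorField.mlieBracket 𝓘(ℝ, F) V' W' = VectorField.lieBracket ℝ V' W' := by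
    have := VectorField.mlieBracketWithin_eq_lieBracketWithin (𝕜 := ℝ) (E := F) (V := V') (W := W')
      (s := Set.univ)
    rw [VectorField.lieBracketWithin_univ] at this
    exact VectorField.mlieBracketWithin_univ.symm.trans this
  have h3 : minSmoothness ℝ 2 ≤ ∞ := by
    rw [minSmoothness_of_isRCLikeNormedField]
    exact WithTop.coe_le_coe.2 (le_top : (2 : ℕ∞) ≤ ⊤)
  have : IsManifold I (minSmoothness ℝ 2) N := .of_le h3
  have h2 : VectorField.mlieBracket I V W y =
      (mvfderiv I f y).inverse (VectorField.lieBracket ℝ V' W' (f y)) := by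
    rw [(key hV).mlieBracket_vectorField_eq (key hW),
      ← VectorField.mpullback_mlieBracket (n := ∞) (hd hV') (hd hW') hf h3, h1]
    rfl
  rw [h2]
  exact hinv.self_of_nhds.self_apply_inverse _

variable {F H N : Type*} [NormedAddCommGroup F] [NormedSpace ℝ F]
    [TopologicalSpace H] {I : ModelWithCorners ℝ F H} [TopologicalSpace N]
    [ChartedSpace H N] [IsManifold I ∞ N]

theorem trivializationAt_tangent_snd {y₀ y : N} (hy : y ∈ (chartAt H y₀).source)
    (v : TangentSpace I y) :
    (trivializationAt F (TangentSpace I : N → Type _) y₀ ⟨y, v⟩).2 =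
      mvfderiv I (extChartAt I y₀) y v := by
  rw [← (trivializationAt F (TangentSpace I : N → Type _) y₀).continuousLinearMapAt_apply_of_mem
    ℝ hy, TangentBundle.continuousLinearMapAt_trivializationAt hy]
  rfl

theorem contMDiffAt_vectorField_iff {y₀ y : N}
    (hy : y ∈ (chartAt H y₀).source) (V : ∀ z : N, TangentSpace I z) :
    ContMDiffAt I I.tangent ∞ (fun z ↦ (⟨z, V z⟩ : TangentBundle I N)) y ↔
      ContMDiffAt I 𝓘(ℝ, F) ∞ (fun z ↦ mvfderiv I (extChartAt I y₀) z (V z)) y := by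
  have h := (trivializationAt F (TangentSpace I : N → Type _) y₀).contMDiffAt_section_iff
    (IB := I) (n := ∞) (s := V) (x₀ := y) hy
  refine h.trans (Filter.EventuallyEq.contMDiffAt_iff ?_)
  filter_upwards [(chartAt H y₀).open_source.mem_nhds hy] with z hz
  exact trivializationAt_tangent_snd hz (V z)

end Brackets

/-! ### Vector fields and curves on the endomorphism bundle in coordinates -/

section EndBrackets

variable {E : Type*} [NormedAddCommGroup E] [NormedSpace ℝ E]
  {M : Type*} [TopologicalSpace M] [ChartedSpace E M] [IsManifold 𝓘(ℝ, E) ∞ M]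

theorem contMDiffAt_end_vectorField_iff {x₀ : M} {A : EndTotal E M}
    (hA : A.1 ∈ (chartAt E x₀).source) (V : ∀ A : EndTotal E M, EndTangent E M A) :
    ContMDiffAt (endModel E) (endModel E).tangent ∞
      (fun B ↦ (⟨B, V B⟩ : TangentBundle (endModel E) (EndTotal E M))) A ↔
      ContMDiffAt (endModel E) 𝓘(ℝ, E × (E →L[ℝ] E)) ∞ (fun B ↦ endChartDeriv x₀ B (V B)) A := by
  have h : A ∈ (extChartAt (endModel E) (⟨x₀, 0⟩ : EndTotal E M)).source := by
    rw [extChartAt_end_source]; exact hA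
  rw [extChartAt_source] at h
  have := contMDiffAt_vectorField_iff (I := endModel E) h V
  rw [extChartAt_end'] at this
  exact this

theorem contMDiffAt_extChartAt_end_symm {x₀ : M} {p : E × (E →L[ℝ] E)}
    (hp : p ∈ (extChartAt (endModel E) (⟨x₀, 0⟩ : EndTotal E M)).target) :
    ContMDiffAt 𝓘(ℝ, E × (E →L[ℝ] E)) (endModel E) ∞
      (extChartAt (endModel E) (⟨x₀, 0⟩ : EndTotal E M)).symm p :=
  (contMDiffOn_extChartAt_symm (I := endModel E) (n := ∞) (⟨x₀, 0⟩ : EndTotal E M)).contMDiffAt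
    ((isOpen_extChartAt_target (I := endModel E) (⟨x₀, 0⟩ : EndTotal E M)).mem_nhds hp)

theorem mem_extChartAt_end_source {x₀ : M} {A : EndTotal E M} :
    A ∈ (extChartAt (endModel E) (⟨x₀, 0⟩ : EndTotal E M)).source ↔
      A.1 ∈ (chartAt E x₀).source := by
  rw [extChartAt_end_source]; rfl

theorem endChart_mem_target {x₀ : M} {A : EndTotal E M} (hA : A.1 ∈ (chartAt E x₀).source) :
    endChart x₀ A ∈ (extChartAt (endModel E) (⟨x₀, 0⟩ : EndTotal E M)).target := by
  have := (extChartAt (endModel E) (⟨x₀, 0⟩ : EndTotal E M)).map_source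
    (mem_extChartAt_end_source.mpr hA)
  rwa [extChartAt_end] at this

theorem extChartAt_end_symm_endChart {x₀ : M} {A : EndTotal E M}
    (hA : A.1 ∈ (chartAt E x₀).source) :
    (extChartAt (endModel E) (⟨x₀, 0⟩ : EndTotal E M)).symm (endChart x₀ A) = A := by
  have := (extChartAt (endModel E) (⟨x₀, 0⟩ : EndTotal E M)).left_inv
    (mem_extChartAt_end_source.mpr hA)
  rwa [extChartAt_end] at this

theorem endChart_extChartAt_end_symm {x₀ : M} {p : E × (E →L[ℝ] E)}
    (hp : p ∈ (extChartAt (endModel E) (⟨x₀, 0⟩ : EndTotal E M)).target) :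
    endChart x₀ ((extChartAt (endModel E) (⟨x₀, 0⟩ : EndTotal E M)).symm p) = p := by
  have := (extChartAt (endModel E) (⟨x₀, 0⟩ : EndTotal E M)).right_inv hp
  rwa [extChartAt_end] at this

theorem eventually_mem_chart_source {x₀ : M} {A : EndTotal E M}
    (hA : A.1 ∈ (chartAt E x₀).source) : ∀ᶠ B : EndTotal E M in 𝓝 A,
      B.1 ∈ (chartAt E x₀).source :=
  (FiberBundle.continuous_proj (E →L[ℝ] E) (EndFiber E M)).continuousAt.eventually
    ((chartAt E x₀).open_source.mem_nhds hA)

theorem exists_coord_vectorField {x₀ : M} {A : EndTotal E M}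
    (hA : A.1 ∈ (chartAt E x₀).source) {V : ∀ A : EndTotal E M, EndTangent E M A}
    (hV : ContMDiffAt (endModel E) (endModel E).tangent ∞
      (fun B ↦ (⟨B, V B⟩ : TangentBundle (endModel E) (EndTotal E M))) A) :
    ∃ V' : E × (E →L[ℝ] E) → E × (E →L[ℝ] E), DifferentiableAt ℝ V' (endChart x₀ A) ∧
      ∀ᶠ B in 𝓝 A, endChartDeriv x₀ B (V B) = V' (endChart x₀ B) := by
  set ψ := extChartAt (endModel E) (⟨x₀, 0⟩ : EndTotal E M) with hψ
  refine ⟨fun p ↦ endChartDeriv x₀ (ψ.symm p) (V (ψ.symm p)), ?_, ?_⟩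
  · have h1 := (contMDiffAt_end_vectorField_iff hA V).mp hV
    have h2 := contMDiffAt_extChartAt_end_symm (endChart_mem_target hA)
    have h3 : ContMDiffAt 𝓘(ℝ, E × (E →L[ℝ] E)) 𝓘(ℝ, E × (E →L[ℝ] E)) ∞
        ((fun B ↦ endChartDeriv x₀ B (V B)) ∘ ψ.symm) (endChart x₀ A) :=
      ContMDiffAt.comp (endChart x₀ A) (by rw [extChartAt_end_symm_endChart hA]; exact h1) h2
    exact h3.contDiffAt.differentiableAt (by simp)
  · filter_upwards [eventually_mem_chart_source hA] with B hB
    rw [hψ, extChartAt_end_symm_endChart hB]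

theorem endChartDeriv_mlieBracket [CompleteSpace (E × (E →L[ℝ] E))] {x₀ : M} {A : EndTotal E M}
    (hA : A.1 ∈ (chartAt E x₀).source) {V W : ∀ A : EndTotal E M, EndTangent E M A}
    {V' W' : E × (E →L[ℝ] E) → E × (E →L[ℝ] E)} (hV' : DifferentiableAt ℝ V' (endChart x₀ A))
    (hW' : DifferentiableAt ℝ W' (endChart x₀ A))
    (hV : ∀ᶠ B in 𝓝 A, endChartDeriv x₀ B (V B) = V' (endChart x₀ B))
    (hW : ∀ᶠ B in 𝓝 A, endChartDeriv x₀ B (W B) = W' (endChart x₀ B)) :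
    endChartDeriv x₀ A (VectorField.mlieBracket (endModel E) V W A) =
      VectorField.lieBracket ℝ V' W' (endChart x₀ A) := by
  refine mvfderiv_mlieBracket (contMDiffAt_endChart hA) ?_ hV' hW' hV hW
  filter_upwards [eventually_mem_chart_source hA] with B hB
  exact isInvertible_endChartDeriv hB

theorem hasDerivAt_endChart_comp {x₀ : M} {γ : ℝ → EndTotal E M} {A : EndTotal E M}
    (hA : A.1 ∈ (chartAt E x₀).source) (hγA : γ 0 = A)
    (hγ : MDifferentiableAt 𝓘(ℝ, ℝ) (endModel E) γ 0) :
    HasDerivAt (fun t ↦ endChart x₀ (γ t))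
      (endChartDeriv x₀ A (mfderiv 𝓘(ℝ, ℝ) (endModel E) γ 0 (1 : ℝ))) 0 := by
  subst hγA
  have h1 : MDifferentiableAt (endModel E) 𝓘(ℝ, E × (E →L[ℝ] E)) (endChart x₀) (γ 0) :=
    (contMDiffAt_endChart hA).mdifferentiableAt (by simp)
  have h2 := h1.hasMFDerivAt.comp (0 : ℝ) hγ.hasMFDerivAt
  have h3 : DifferentiableAt ℝ (fun t ↦ endChart x₀ (γ t)) 0 :=
    h2.mdifferentiableAt.differentiableAt
  refine h3.hasDerivAt.congr_deriv ?_
  rw [← fderiv_apply_one_eq_deriv, ← mfderiv_eq_fderiv]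
  exact DFunLike.congr_fun h2.mfderiv (1 : ℝ)

theorem IsTangentTo.exists_coord_curve {S : Set (EndTotal E M)} {S' : Set (E × (E →L[ℝ] E))}
    {x₀ : M} {A : EndTotal E M} (hA : A.1 ∈ (chartAt E x₀).source)
    (hS : ∀ᶠ B in 𝓝 A, B ∈ S → endChart x₀ B ∈ S') {W : EndTangent E M A}
    (hW : IsTangentTo S A W) : ∃ γ : ℝ → E × (E →L[ℝ] E), γ 0 = endChart x₀ A ∧
      (∀ᶠ t in 𝓝 0, γ t ∈ S') ∧ HasDerivAt γ (endChartDeriv x₀ A W) 0 := by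
  obtain ⟨γ, hγA, hγS, hγ, rfl⟩ := hW
  refine ⟨fun t ↦ endChart x₀ (γ t), congrArg _ hγA, ?_,
    hasDerivAt_endChart_comp hA hγA (hγ.mdifferentiableAt (by simp))⟩
  have hc : Filter.Tendsto γ (𝓝 0) (𝓝 A) := hγA ▸ hγ.continuousAt
  filter_upwards [hγS, hc.eventually hS] with t ht ht'
  exact ht' ht

theorem isTangentTo_of_coord_curve {S : Set (EndTotal E M)} {S' : Set (E × (E →L[ℝ] E))}
    {x₀ : M} {A : EndTotal E M} (hA : A.1 ∈ (chartAt E x₀).source)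
    (hS : ∀ᶠ B in 𝓝 A, endChart x₀ B ∈ S' → B ∈ S) {W : EndTangent E M A}
    {γ : ℝ → E × (E →L[ℝ] E)} (hγA : γ 0 = endChart x₀ A) (hγS : ∀ᶠ t in 𝓝 0, γ t ∈ S')
    (hγ : ContDiffAt ℝ ∞ γ 0) (hγW : HasDerivAt γ (endChartDeriv x₀ A W) 0) :
    IsTangentTo S A W := by
  set ψ := extChartAt (endModel E) (⟨x₀, 0⟩ : EndTotal E M) with hψ
  have h0 : ψ.symm (γ 0) = A := by rw [hγA, extChartAt_end_symm_endChart hA]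
  have h1 : ContMDiffAt 𝓘(ℝ, ℝ) (endModel E) ∞ (fun t ↦ ψ.symm (γ t)) 0 :=
    ContMDiffAt.comp (0 : ℝ)
      (by rw [hγA]; exact contMDiffAt_extChartAt_end_symm (endChart_mem_target hA))
      hγ.contMDiffAt
  have hγt : ∀ᶠ t in 𝓝 0, γ t ∈ ψ.target :=
    hγ.continuousAt.eventually ((isOpen_extChartAt_target _).mem_nhds
      (by rw [hγA]; exact endChart_mem_target hA))
  have h2 : ∀ᶠ t in 𝓝 0, endChart x₀ (ψ.symm (γ t)) = γ t := by
    filter_upwards [hγt] with t ht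
    exact endChart_extChartAt_end_symm ht
  refine ⟨fun t ↦ ψ.symm (γ t), h0, ?_, h1, ?_⟩
  · have hc : Filter.Tendsto (fun t ↦ ψ.symm (γ t)) (𝓝 0) (𝓝 A) := by
      have := h1.continuousAt
      rwa [ContinuousAt, h0] at this
    filter_upwards [hc.eventually hS, h2, hγS] with t ht ht' ht''
    exact ht (by rwa [ht'])
  · apply endChartDeriv_injective hA
    exact hγW.unique ((hasDerivAt_endChart_comp hA h0
      (h1.mdifferentiableAt (by simp))).congr_of_eventuallyEq (h2.mono fun t ht ↦ ht.symm))

theorem eventually_nhds_endChart {x₀ : M} {A : EndTotal E M} (hA : A.1 ∈ (chartAt E x₀).source)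
    {P : E × (E →L[ℝ] E) → Prop} (h : ∀ᶠ B in 𝓝 A, P (endChart x₀ B)) :
    ∀ᶠ q in 𝓝 (endChart x₀ A), P q := by
  have hp := endChart_mem_target hA
  have h1 := (contMDiffAt_extChartAt_end_symm hp).continuousAt
  rw [ContinuousAt, extChartAt_end_symm_endChart hA] at h1
  filter_upwards [h1.eventually h,
    (isOpen_extChartAt_target (I := endModel E) (⟨x₀, 0⟩ : EndTotal E M)).mem_nhds hp] with q hq hq'
  rwa [endChart_extChartAt_end_symm hq'] at hq

/-- The part of `End(TM)` over the open set with coordinates in `D`. -/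
def endDomain (M : Type*) [TopologicalSpace M] [ChartedSpace E M] [IsManifold 𝓘(ℝ, E) ∞ M]
    (x₀ : M) (D : Set E) : Set (EndTotal E M) :=
  {B | B.1 ∈ (chartAt E x₀).source ∧ extChartAt 𝓘(ℝ, E) x₀ B.1 ∈ D}

theorem isOpen_endDomain {x₀ : M} {D : Set E} (hD : IsOpen D) : IsOpen (endDomain M x₀ D) := by
  have h1 : IsOpen ((chartAt E x₀).source ∩ extChartAt 𝓘(ℝ, E) x₀ ⁻¹' D) := by
    have := (continuousOn_extChartAt (I := 𝓘(ℝ, E)) x₀).isOpen_inter_preimage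
      (isOpen_extChartAt_source x₀) hD
    rwa [extChartAt_source] at this
  exact h1.preimage (FiberBundle.continuous_proj (E →L[ℝ] E) (EndFiber E M))

end EndBrackets

/-! ### The torsion in coordinates -/

section Torsion

variable {E : Type*} [NormedAddCommGroup E] [NormedSpace ℝ E] [FiniteDimensional ℝ E]
  [CompleteSpace E]
  {M : Type*} [TopologicalSpace M] [ChartedSpace E M] [IsManifold 𝓘(ℝ, E) ∞ M]
  (cov : CovariantDerivative 𝓘(ℝ, E) E (TangentSpace 𝓘(ℝ, E) : M → Type _))

/-- The coordinate fields commute, so the torsion is the antisymmetric part of the Christoffel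
symbols. -/
theorem toCoord_torsion {x₀ y : M} (hy : y ∈ (chartAt E x₀).source)
    (X Y : TangentSpace 𝓘(ℝ, E) y) :
    toCoord x₀ y (cov.torsion y X Y) =
      localTorsion (christoffel cov x₀ y) (toCoord x₀ y X) (toCoord x₀ y Y) := by
  have hd : ∀ v : E, MDifferentiableAt 𝓘(ℝ, E) 𝓘(ℝ, E).tangent
      (fun z ↦ (⟨z, ofCoord x₀ z v⟩ : TangentBundle 𝓘(ℝ, E) M)) y := fun v ↦
    mdifferentiableAt_ofCoord hy mdifferentiableAt_const
  have hc : ∀ v : E, ∀ᶠ z in 𝓝 y,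
      mvfderiv 𝓘(ℝ, E) (extChartAt 𝓘(ℝ, E) x₀) z (ofCoord x₀ z v) = v := fun v ↦ by
    filter_upwards [(chartAt E x₀).open_source.mem_nhds hy] with z hz
    have := toCoord_ofCoord hz v
    rwa [toCoord_eq_mfderiv hz] at this
  have hb : ∀ v w : E, toCoord x₀ y (VectorField.mlieBracket 𝓘(ℝ, E)
      (fun z ↦ ofCoord x₀ z v) (fun z ↦ ofCoord x₀ z w) y) = 0 := fun v w ↦ by
    have h1 := mvfderiv_mlieBracket (I := 𝓘(ℝ, E)) (f := extChartAt 𝓘(ℝ, E) x₀) (y := y)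
      (V := fun z ↦ ofCoord x₀ z v) (W := fun z ↦ ofCoord x₀ z w)
      (V' := fun _ ↦ v) (W' := fun _ ↦ w) (contMDiffAt_extChartAt' hy) (by
        filter_upwards [(chartAt E x₀).open_source.mem_nhds hy] with z hz
        exact isInvertible_mfderiv_extChartAt (by rwa [extChartAt_source]))
      (differentiableAt_const v) (differentiableAt_const w) (hc v) (hc w)
    rw [toCoord_eq_mfderiv hy]
    refine Eq.trans h1 ?_
    simp [VectorField.lieBracket]
  have hm : ∀ v : E, mvfderiv 𝓘(ℝ, E) (fun _ : M ↦ v) y = 0 := fun v ↦ by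
    simp [mvfderiv]
  have h1 := cov.torsion_apply (hd (toCoord x₀ y X)) (hd (toCoord x₀ y Y))
  rw [ofCoord_toCoord hy, ofCoord_toCoord hy] at h1
  rw [h1, map_sub, map_sub, hb, toCoord_cov cov hy mdifferentiableAt_const,
    toCoord_cov cov hy mdifferentiableAt_const, hm, hm]
  simp [localTorsion]

end Torsion

/-! ### Integrability of the twistor space -/

section Integrability

variable {E : Type*} [NormedAddCommGroup E] [NormedSpace ℝ E] [FiniteDimensional ℝ E]
  {M : Type*} [TopologicalSpace M] [ChartedSpace E M] [IsManifold 𝓘(ℝ, E) ∞ M]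
  {Q : AlmostQuaternionicStructure E M}
  {cov : CovariantDerivative 𝓘(ℝ, E) E (TangentSpace 𝓘(ℝ, E) : M → Type _)}
  {x₀ : M} {D : Set E} {J₁ J₂ J₃ : E → E →L[ℝ] E}

theorem toCoord_part02_torsion [CompleteSpace E] {A : EndTotal E M}
    (hA : A.1 ∈ (chartAt E x₀).source) (X Y : TangentSpace 𝓘(ℝ, E) A.1) :
    toCoord x₀ A.1 (part02 (fun X Y ↦ cov.torsion A.1 X Y) A.2 X Y) =
      (1 / 4 : ℝ) • antiPart (localTorsion (christoffel cov x₀ A.1)) (endChart x₀ A).2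
        (endChart x₀ A).2 (toCoord x₀ A.1 X) (toCoord x₀ A.1 Y) := by
  have h (v : TangentSpace 𝓘(ℝ, E) A.1) :
      toCoord x₀ A.1 (A.2 v) = endCoord x₀ A.1 A.2 (toCoord x₀ A.1 v) :=
    (endCoord_apply_toCoord hA A.2 v).symm
  simp only [part02, antiPart, map_smul, map_sub, h, toCoord_torsion cov hA, endChart]

theorem christoffel_endChart {A : EndTotal E M} (hA : A.1 ∈ (chartAt E x₀).source) :
    christoffel cov x₀ ((extChartAt 𝓘(ℝ, E) x₀).symm (endChart x₀ A).1) =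
      christoffel cov x₀ A.1 :=
  congrArg _ ((extChartAt 𝓘(ℝ, E) x₀).left_inv (by rwa [extChartAt_source]))

/-- The horizontal field over a coordinate expression `g`, which may depend on the point of
`End(TM)`. -/
theorem endChartDeriv_horizontalField (g : E × (E →L[ℝ] E) → E) {A : EndTotal E M}
    (hA : A.1 ∈ (chartAt E x₀).source) :
    letI q := endChart x₀ A
    letI c := christoffel cov x₀ ((extChartAt 𝓘(ℝ, E) x₀).symm q.1) (g q)
    endChartDeriv x₀ A (horizontalLift cov A (ofCoord x₀ A.1 (g (endChart x₀ A)))) =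
      (g q, -(c * q.2 - q.2 * c)) := by
  simp only [endChartDeriv_horizontalLift cov hA, toCoord_ofCoord hA, christoffel_endChart hA]
  rfl

/-- Horizontal fields are tangent to the twistor space, since the connection preserves `Q`. -/
theorem isVectorFieldAlong_horizontalField
    (h : IsLocalQuaternionicConnection D
      (fun x ↦ christoffel cov x₀ ((extChartAt 𝓘(ℝ, E) x₀).symm x)) J₁ J₂ J₃)
    (hZ : ∀ A ∈ endDomain M x₀ D,
      (A ∈ Q.twistorSpace ↔ endChart x₀ A ∈ localTwistorSpace D J₁ J₂ J₃))
    {g : E × (E →L[ℝ] E) → E} (hg : ContDiff ℝ ∞ g) :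
    IsVectorFieldAlong Q.twistorSpace (endDomain M x₀ D)
      (fun A ↦ horizontalLift cov A (ofCoord x₀ A.1 (g (endChart x₀ A)))) where
  smooth A hA := by
    refine ((contMDiffAt_end_vectorField_iff hA.1 _).mpr ?_).contMDiffWithinAt
    let Γ : E → E →L[ℝ] E →L[ℝ] E := fun x ↦
      christoffel cov x₀ ((extChartAt 𝓘(ℝ, E) x₀).symm x)
    let G : E × (E →L[ℝ] E) → E × (E →L[ℝ] E) := fun q ↦
      (g q, -(Γ q.1 (g q) * q.2 - q.2 * Γ q.1 (g q)))
    have hG : ContDiffAt ℝ ∞ G (endChart x₀ A) := by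
      have hΓ : ContDiffAt ℝ ∞ (fun q : E × (E →L[ℝ] E) ↦ Γ q.1 (g q)) (endChart x₀ A) :=
        (ContDiffAt.comp (endChart x₀ A)
          (h.contDiffOn.contDiffAt (h.isOpen.mem_nhds hA.2)) contDiffAt_fst).clm_apply hg.contDiffAt
      exact hg.contDiffAt.prodMk ((hΓ.mul contDiffAt_snd).sub (contDiffAt_snd.mul hΓ)).neg
    refine ContMDiffAt.congr_of_eventuallyEq
      (ContMDiffAt.comp A hG.contMDiffAt (contMDiffAt_endChart hA.1)) ?_
    filter_upwards [eventually_mem_chart_source hA.1] with B hB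
    exact endChartDeriv_horizontalField g hB
  tangent A hA := by
    obtain ⟨γ, hγ0, hγ, hγs, hγ'⟩ :=
      h.exists_horizontal_curve ((hZ A hA.2).mp hA.1) (g (endChart x₀ A))
    refine isTangentTo_of_coord_curve hA.2.1 ?_ hγ0 hγ hγs
      (hγ'.congr_deriv (endChartDeriv_horizontalField g hA.2.1).symm)
    filter_upwards [(isOpen_endDomain h.isOpen).mem_nhds hA.2] with B hB
    exact (hZ B hB).mpr

theorem twistorI_horizontalField {A : EndTotal E M} (hA : A.1 ∈ (chartAt E x₀).source) (ξ : E) :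
    twistorI cov A (horizontalLift cov A (ofCoord x₀ A.1 ξ)) =
      horizontalLift cov A (ofCoord x₀ A.1 ((endChart x₀ A).2 ξ)) := by
  apply endChartDeriv_injective hA
  rw [endChartDeriv_twistorI cov hA, endChartDeriv_horizontalField (fun _ ↦ ξ) hA,
    endChartDeriv_horizontalField (fun q ↦ q.2 ξ) hA, christoffel_endChart hA]
  simp [localTwistorI]

/-- The Nijenhuis tensor of the twistor space in coordinates. Its first component is, up to the
factor `-4`, the `(0,2)`-part of the torsion. -/
theorem endChartDeriv_nijenhuis [CompleteSpace E]
    (h : IsLocalQuaternionicConnection D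
      (fun x ↦ christoffel cov x₀ ((extChartAt 𝓘(ℝ, E) x₀).symm x)) J₁ J₂ J₃)
    (hZ : ∀ A ∈ endDomain M x₀ D,
      (A ∈ Q.twistorSpace ↔ endChart x₀ A ∈ localTwistorSpace D J₁ J₂ J₃))
    {O : Set (EndTotal E M)} {U W U' W' : ∀ A : EndTotal E M, EndTangent E M A} (hO : IsOpen O)
    (hU : IsVectorFieldAlong Q.twistorSpace O U) (hW : IsVectorFieldAlong Q.twistorSpace O W)
    (hU' : IsVectorFieldAlong Q.twistorSpace O U') (hW' : IsVectorFieldAlong Q.twistorSpace O W')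
    (hI : ∀ A ∈ Q.twistorSpace ∩ O, U' A = twistorI cov A (U A) ∧ W' A = twistorI cov A (W A))
    {A : EndTotal E M} (hA : A ∈ Q.twistorSpace ∩ O) (hAD : A ∈ endDomain M x₀ D) :
    letI p := endChart x₀ A
    letI Γ : E → E →L[ℝ] E →L[ℝ] E := fun x ↦
      christoffel cov x₀ ((extChartAt 𝓘(ℝ, E) x₀).symm x)
    letI ξ := (endChartDeriv x₀ A (U A)).1
    letI η := (endChartDeriv x₀ A (W A)).1
    letI N₁ := - antiPart (localTorsion (Γ p.1)) p.2 p.2 ξ η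
    endChartDeriv x₀ A
      (VectorField.mlieBracket (endModel E) U' W' A - VectorField.mlieBracket (endModel E) U W A
        - twistorI cov A (VectorField.mlieBracket (endModel E) U' W A)
        - twistorI cov A (VectorField.mlieBracket (endModel E) U W' A)) =
    (N₁, -(Γ p.1 N₁ * p.2 - p.2 * Γ p.1 N₁)
      - antiPart (fun X Y ↦ localCurvature (Γ p.1) (fderiv ℝ Γ p.1) X Y * p.2
        - p.2 * localCurvature (Γ p.1) (fderiv ℝ Γ p.1) X Y) p.2 (p.2 * ·) ξ η) := by
  have hs : ∀ {V : ∀ A : EndTotal E M, EndTangent E M A},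
      IsVectorFieldAlong Q.twistorSpace O V → ContMDiffAt (endModel E) (endModel E).tangent ∞
        (fun B ↦ (⟨B, V B⟩ : TangentBundle (endModel E) (EndTotal E M))) A := fun hV ↦
    hV.smooth.contMDiffAt (hO.mem_nhds hA.2)
  obtain ⟨u, hu, hUu⟩ := exists_coord_vectorField hAD.1 (hs hU)
  obtain ⟨w, hw, hWw⟩ := exists_coord_vectorField hAD.1 (hs hW)
  obtain ⟨u', hu', hUu'⟩ := exists_coord_vectorField hAD.1 (hs hU')
  obtain ⟨w', hw', hWw'⟩ := exists_coord_vectorField hAD.1 (hs hW')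
  have hDn := (isOpen_endDomain (M := M) (x₀ := x₀) h.isOpen).mem_nhds hAD
  have hcoord : ∀ᶠ q in 𝓝 (endChart x₀ A), q ∈ localTwistorSpace D J₁ J₂ J₃ →
      u' q = localTwistorI (christoffel cov x₀ ((extChartAt 𝓘(ℝ, E) x₀).symm q.1)) q.2 (u q) ∧
      w' q = localTwistorI (christoffel cov x₀ ((extChartAt 𝓘(ℝ, E) x₀).symm q.1)) q.2 (w q) := by
    refine eventually_nhds_endChart hAD.1 ?_
    filter_upwards [hDn, hO.mem_nhds hA.2, hUu, hWw, hUu', hWw'] with B hB hBO h1 h2 h3 h4 hBZ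
    obtain ⟨hI1, hI2⟩ := hI B ⟨(hZ B hB).mpr hBZ, hBO⟩
    rw [← h1, ← h2, ← h3, ← h4, christoffel_endChart hB.1, hI1, hI2,
      endChartDeriv_twistorI cov hB.1, endChartDeriv_twistorI cov hB.1]
    exact ⟨rfl, rfl⟩
  have hcurve : ∀ v ∈ ({u (endChart x₀ A), w (endChart x₀ A), u' (endChart x₀ A),
      w' (endChart x₀ A)} : Set (E × (E →L[ℝ] E))),
      ∃ γ : ℝ → E × (E →L[ℝ] E), γ 0 = endChart x₀ A ∧
        (∀ᶠ t in 𝓝 0, γ t ∈ localTwistorSpace D J₁ J₂ J₃) ∧ HasDerivAt γ v 0 := by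
    have hS : ∀ᶠ B in 𝓝 A, B ∈ Q.twistorSpace →
        endChart x₀ B ∈ localTwistorSpace D J₁ J₂ J₃ := by
      filter_upwards [hDn] with B hB
      exact (hZ B hB).mp
    rw [← hUu.self_of_nhds, ← hWw.self_of_nhds, ← hUu'.self_of_nhds, ← hWw'.self_of_nhds]
    rintro v (rfl | rfl | rfl | rfl)
    exacts [(hU.tangent A hA).exists_coord_curve hAD.1 hS,
      (hW.tangent A hA).exists_coord_curve hAD.1 hS,
      (hU'.tangent A hA).exists_coord_curve hAD.1 hS,
      (hW'.tangent A hA).exists_coord_curve hAD.1 hS]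
  have key := h.nijenhuis_eq ((hZ A hAD).mp hA.1) hu hw hu' hw' hcoord hcurve
  rw [← endChartDeriv_mlieBracket hAD.1 hu' hw' hUu' hWw',
    ← endChartDeriv_mlieBracket hAD.1 hu hw hUu hWw,
    ← endChartDeriv_mlieBracket hAD.1 hu' hw hUu' hWw,
    ← endChartDeriv_mlieBracket hAD.1 hu hw' hUu hWw'] at key
  simp only [christoffel_endChart hAD.1, ← endChartDeriv_twistorI cov hAD.1,
    ← hUu.self_of_nhds, ← hWw.self_of_nhds] at key ⊢
  refine Eq.trans ?_ key
  refine (ContinuousLinearMap.map_sub _ _ _).trans (congrArg (· - _) ?_)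
  refine (ContinuousLinearMap.map_sub _ _ _).trans (congrArg (· - _) ?_)
  exact ContinuousLinearMap.map_sub _ _ _

/-- The equivalence in every finite-dimensional model space; the condition `7 ≤ dim E` excludes
dimension four. -/
theorem IsQuaternionicConnection.twistorIntegrable_iff [CompleteSpace E] [T2Space M]
    (hcov : IsQuaternionicConnection Q cov) (hE : 7 ≤ Module.finrank ℝ E) :
    TwistorIntegrable Q cov ↔ ∀ J ∈ Q.twistorSpace, ∀ X Y : TangentSpace 𝓘(ℝ, E) J.1,
      part02 (fun X Y ↦ cov.torsion J.1 X Y) J.2 X Y = 0 := by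
  constructor
  · intro hint J hJ X Y
    obtain ⟨D, J₁, J₂, J₃, h, hD, -, hZ⟩ := hcov.exists_local J.1
    have hJs : J.1 ∈ (chartAt E J.1).source := mem_chart_source E J.1
    have hZ' : ∀ A ∈ endDomain M J.1 D,
        (A ∈ Q.twistorSpace ↔ endChart J.1 A ∈ localTwistorSpace D J₁ J₂ J₃) :=
      fun A hA ↦ hZ A hA.1 hA.2
    -- evaluate the Nijenhuis tensor on the horizontal lifts `U`, `W` of the coordinate fields `ξ`,
    -- `η`; then `I U`, `I W` are the horizontal fields over `a ξ`, `a η`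
    have hv : ∀ ξ : E, ContDiff ℝ ∞ (fun _ : E × (E →L[ℝ] E) ↦ ξ) := fun ξ ↦ contDiff_const
    have hv' : ∀ ξ : E, ContDiff ℝ ∞ (fun q : E × (E →L[ℝ] E) ↦ q.2 ξ) := fun ξ ↦
      contDiff_snd.clm_apply contDiff_const
    set ξ := toCoord J.1 J.1 X
    set η := toCoord J.1 J.1 Y
    have hO : IsOpen (endDomain M J.1 D) := isOpen_endDomain h.isOpen
    have hU := isVectorFieldAlong_horizontalField h hZ' (hv ξ)
    have hW := isVectorFieldAlong_horizontalField h hZ' (hv η)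
    have hU' := isVectorFieldAlong_horizontalField h hZ' (hv' ξ)
    have hW' := isVectorFieldAlong_horizontalField h hZ' (hv' η)
    have hI := fun (A : EndTotal E M) (hA : A ∈ Q.twistorSpace ∩ endDomain M J.1 D) ↦
      And.intro (twistorI_horizontalField (cov := cov) hA.2.1 ξ).symm
        (twistorI_horizontalField (cov := cov) hA.2.1 η).symm
    have hJO : J ∈ Q.twistorSpace ∩ endDomain M J.1 D := ⟨hJ, hJs, hD⟩
    have h1 := endChartDeriv_nijenhuis h hZ' hO hU hW hU' hW' hI hJO hJO.2
    rw [hint _ _ _ _ _ hO hU hW hU' hW' hI J hJO] at h1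
    have h2 := congrArg Prod.fst ((ContinuousLinearMap.map_zero _).symm.trans h1)
    simp only [endChartDeriv_horizontalField (fun _ ↦ ξ) hJs,
      endChartDeriv_horizontalField (fun _ ↦ η) hJs, christoffel_endChart hJs] at h2
    have h3 := toCoord_part02_torsion (cov := cov) hJs X Y
    rw [neg_eq_zero.mp h2.symm, smul_zero] at h3
    rw [← ofCoord_toCoord hJs (part02 _ _ X Y), h3, map_zero]
  · intro hT O U W U' W' hO hU hW hU' hW' hI A hA
    obtain ⟨D, J₁, J₂, J₃, h, hD, hDt, hZ⟩ := hcov.exists_local A.1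
    have hAs : A.1 ∈ (chartAt E A.1).source := mem_chart_source E A.1
    have hZ' : ∀ B ∈ endDomain M A.1 D,
        (B ∈ Q.twistorSpace ↔ endChart A.1 B ∈ localTwistorSpace D J₁ J₂ J₃) :=
      fun B hB ↦ hZ B hB.1 hB.2
    have hAD : A ∈ endDomain M A.1 D := ⟨hAs, hD⟩
    have hT' : ∀ q ∈ localTwistorSpace D J₁ J₂ J₃, ∀ Y Z, antiPart (localTorsion
        (christoffel cov A.1 ((extChartAt 𝓘(ℝ, E) A.1).symm q.1))) q.2 q.2 Y Z = 0 := by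
      intro q hq Y Z
      set y := (extChartAt 𝓘(ℝ, E) A.1).symm q.1 with hy
      have hys : y ∈ (chartAt E A.1).source := extChartAt_symm_mem (hDt hq.1)
      let B : EndTotal E M := ⟨y, endOfCoord A.1 y q.2⟩
      have hB : endChart A.1 B = q :=
        Prod.ext ((extChartAt 𝓘(ℝ, E) A.1).right_inv (hDt hq.1)) (endCoord_endOfCoord hys q.2)
      have hBD : B ∈ endDomain M A.1 D := by
        refine ⟨hys, ?_⟩
        have := hq.1
        rwa [← hB] at this
      have h1 := toCoord_part02_torsion (cov := cov) (A := B) hys (ofCoord A.1 y Y)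
        (ofCoord A.1 y Z)
      rw [hT B ((hZ' B hBD).mpr (hB ▸ hq)), map_zero, hB, toCoord_ofCoord hys,
        toCoord_ofCoord hys] at h1
      simpa using h1.symm
    have h1 := endChartDeriv_nijenhuis h hZ' hO hU hW hU' hW' hI hA hAD
    have hAZ := (hZ' A hAD).mp hA.1
    rw [h.antiPart_curvature_eq_zero hE hT' hAZ, hT' _ hAZ] at h1
    apply endChartDeriv_injective hAs
    refine h1.trans (Eq.trans ?_ (ContinuousLinearMap.map_zero _).symm)
    simp

end Integrability

theorem theoremt2p1 (n : ℕ) (hn : 2 ≤ n)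
    {M : Type*} [TopologicalSpace M] [T2Space M] [SecondCountableTopology M]
    [ChartedSpace (EuclideanSpace ℝ (Fin (4 * n))) M]
    [IsManifold 𝓘(ℝ, EuclideanSpace ℝ (Fin (4 * n))) ∞ M]
    (Q : AlmostQuaternionicStructure (EuclideanSpace ℝ (Fin (4 * n))) M)
    (cov : CovariantDerivative 𝓘(ℝ, EuclideanSpace ℝ (Fin (4 * n)))
      (EuclideanSpace ℝ (Fin (4 * n)))
      (TangentSpace 𝓘(ℝ, EuclideanSpace ℝ (Fin (4 * n))) : M → Type _))
    (hcov : IsQuaternionicConnection Q cov) :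
    TwistorIntegrable Q cov ↔
      ∀ J ∈ Q.twistorSpace, ∀ X Y : TangentSpace 𝓘(ℝ, EuclideanSpace ℝ (Fin (4 * n))) J.1,
        part02 (fun X Y ↦ cov.torsion J.1 X Y) J.2 X Y = 0 := by
  refine hcov.twistorIntegrable_iff ?_
  rw [finrank_euclideanSpace_fin]
  omega
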